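/- Let $M_n$ be the space of complex $n\times n$ matrices. A random vector $X$ in a real normed space $V$ satisfies the (subgaussian) convex concentration property with parameters $K,\kappa>0$ if for every convex $1$-Lipschitz function $f:V\to\mathbb{R}$ there is a median $M_f$ of $f(X)$ with \[ \mathbb{P}\bigl[|f(X)-M_f|\ge t\bigr]\le K e^{-\kappa t^2}\qquad\text{for all } t>0 . \] For $p>0$ and $A\in M_n$ put $\|A\|_p=\bigl(\operatorname{tr}(A^*A)^{p/2}\bigr)^{1/p}$. A noncommutative $*$-polynomial in $m$ variables is a complex linear combination of words in the letters $x_1,\dots,x_m,x_1^*,\dots,x_m^*$; its degree is at most $d$ if every word occurring in it has length at most $d$. Theorem. Let $m\ge 0$ and $d\ge 1$ be integers and let $K,\kappa>0$. There are constants $C,c>0$ depending only on $m,d,K,\kappa$ such that the following holds for every $n$. Let $X_1,\dots,X_m$ be independent random matrices in $M_n$, each satisfying the convex concentration property with parameters $K,\kappa$ with respect to the Hilbert–Schmidt norm $\|\cdot\|_2$ on $M_n$, and each centered, $\mathbb{E}X_j=0$. Let $P$ be a noncommutative $*$-polynomial in $m$ variables of degree at most $d$ all of whose coefficients have modulus at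 most $1$, and let \[ Z_P=\operatorname{tr}P\Bigl(\frac{X_1}{\sqrt n},\dots,\frac{X_m}{\sqrt n}\Bigr) \] (unnormalized trace). Then $Z_P$ is integrable and, for all $t>0$, \[ \mathbb{P}\bigl[|Z_P-\mathbb{E}Z_P|\ge t\bigr]\le C\exp\bigl[-c\min\{t^2,\;n\,t^{2/d}\}\bigr]. \] The same conclusion holds without the assumption that the $X_j$ are centered if, when $d\ge 2$, one assumes instead that \[ \|\mathbb{E}X_j\|_{2(d-1)}\le C_0\, n^{d/(2(d-1))}\qquad\text{for all } j, \] where $C_0>0$ is a constant; then $C,c$ depend only on $m,d,K,\kappa$ and $C_0$. For $d=1$ no assumption on the means is needed. -/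

import Mathlib

open MeasureTheory ProbabilityTheory
open scoped Matrix

/-- The sigma-algebra on `M_n` generated by the (complex) matrix entries. -/
noncomputable instance instMeasurableSpaceComplexMatrix (n : ℕ) :
    MeasurableSpace (Matrix (Fin n) (Fin n) ℂ) :=
  inferInstanceAs (MeasurableSpace (Fin n → Fin n → ℂ))

/-- It is also the Borel sigma-algebra. -/
instance instBorelSpaceComplexMatrix (n : ℕ) :
    BorelSpace (Matrix (Fin n) (Fin n) ℂ) :=
  inferInstanceAs (BorelSpace (Fin n → Fin n → ℂ))

/-- `M` is a median of the real random variable `Y`. -/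
def IsMedian {Ω : Type*} [MeasurableSpace Ω] (μ : Measure Ω) (Y : Ω → ℝ) (M : ℝ) : Prop :=
  1 / 2 ≤ μ.real {ω | Y ω ≤ M} ∧ 1 / 2 ≤ μ.real {ω | M ≤ Y ω}

/-- The (subgaussian) convex concentration property with parameters `K` and `κ` of a random
vector `X` in a normed space `V`: every convex 1-Lipschitz function of `X` satisfies a subgaussian
tail bound around a median. -/
def ConvexConcentration {Ω : Type*} [MeasurableSpace Ω] (μ : Measure Ω)
    {V : Type*} [NormedAddCommGroup V] [NormedSpace ℝ V]
    (X : Ω → V) (K κ : ℝ) : Prop :=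
  ∀ f : V → ℝ, ConvexOn ℝ Set.univ f → LipschitzWith 1 f →
    ∃ M : ℝ, IsMedian μ (fun ω => f (X ω)) M ∧
      ∀ t : ℝ, 0 < t → μ.real {ω | t ≤ |f (X ω) - M|} ≤ K * Real.exp (-κ * t ^ 2)

section HilbertSchmidt

open scoped Matrix.Norms.Frobenius

/-- The convex concentration property of a random matrix in `M_n`, regarded as a real vector space
with the Hilbert–Schmidt (Frobenius) norm. -/
def HSConvexConcentration {Ω : Type*} [MeasurableSpace Ω] (μ : Measure Ω) {n : ℕ}
    (X : Ω → Matrix (Fin n) (Fin n) ℂ) (K κ : ℝ) : Prop :=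
  ConvexConcentration μ X K κ

end HilbertSchmidt

/-- The mean `E X` of a random matrix, taken entry by entry. -/
noncomputable def meanMatrix {Ω : Type*} [MeasurableSpace Ω] (μ : Measure Ω) {n : ℕ}
    (X : Ω → Matrix (Fin n) (Fin n) ℂ) : Matrix (Fin n) (Fin n) ℂ :=
  Matrix.of fun i j => ∫ ω, X ω i j ∂μ

/-- The Schatten `p`-norm `(tr (A* A)^(p/2))^(1/p)`, for real `p > 0`; the trace of the power
`p/2` of the positive semidefinite matrix `A* A` is the sum of the powers of its eigenvalues. -/
noncomputable def schattenNorm {n : ℕ} (p : ℝ) (A : Matrix (Fin n) (Fin n) ℂ) : ℝ :=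
  (∑ i, (Matrix.isHermitian_conjTranspose_mul_self A).eigenvalues i ^ (p / 2)) ^ (1 / p)

/-- Noncommutative *-polynomials in `m` variables: complex linear combinations of words in the
letters `Sum.inl j`, standing for `x_j`, and `Sum.inr j`, standing for `x_j*`. -/
abbrev NCStarPolynomial (m : ℕ) : Type :=
  MonoidAlgebra ℂ (FreeMonoid (Fin m ⊕ Fin m))

namespace NCStarPolynomial

/-- All the monomials of `P` have length at most `d`. -/
def DegreeLE {m : ℕ} (P : NCStarPolynomial m) (d : ℕ) : Prop :=
  ∀ w : FreeMonoid (Fin m ⊕ Fin m), P.coeff w ≠ 0 → w.length ≤ d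

/-- All the coefficients of `P` have modulus at most `1`. -/
def Normalized {m : ℕ} (P : NCStarPolynomial m) : Prop :=
  ∀ w : FreeMonoid (Fin m ⊕ Fin m), ‖P.coeff w‖ ≤ 1

/-- The value `P(A_1, …, A_m)` of a noncommutative *-polynomial at a tuple of matrices. -/
noncomputable def eval {m n : ℕ} (A : Fin m → Matrix (Fin n) (Fin n) ℂ)
    (P : NCStarPolynomial m) : Matrix (Fin n) (Fin n) ℂ :=
  MonoidAlgebra.lift ℂ (Matrix (Fin n) (Fin n) ℂ) (FreeMonoid (Fin m ⊕ Fin m))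
    (FreeMonoid.lift (Sum.elim A (fun j => (A j)ᴴ))) P

end NCStarPolynomial

/-- The complex random variable `Z_P = tr P(X_1/√n, …, X_m/√n)` (unnormalized trace). -/
noncomputable def traceStatistic {Ω : Type*} {m n : ℕ} (P : NCStarPolynomial m)
    (X : Fin m → Ω → Matrix (Fin n) (Fin n) ℂ) (ω : Ω) : ℂ :=
  (P.eval (fun j => (Real.sqrt n)⁻¹ • X j ω)).trace

/-! The trace of a word is reduced to convex functions of Hermitian matrices. Pad the word with
identities to length `d` and put its letters in the positions `(k, k + 1)` of a cyclic block matrix: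
the trace of the `d`-th power of that matrix is `d` times the trace of the word
(`trace_cyclicBlock_pow`). Averaging over roots of unity of order `2d + 1` replaces the block matrix
by Hermitian matrices `H` that are affine in the `X_j` (`sum_trace_hermPart_pow`), and `tr H^d`
splits into the traces of the `d`-th powers of the positive and negative parts, both convex
(`trace_pow_eq_posPartTrace`).

These convex functions are not globally Lipschitz: by Peierls' inequality and Cauchy–Schwarz the
slope at `H` is at most `d ‖H‖^(d-1)` in the Schatten norm of order `2(d-1)`
(`posPartTrace_tangent`, `sum_posPartSlope_mul_le`). However, the supremum of the tangents taken at
points of slope at most `L` is convex and `L`-Lipschitz, and agrees with the function at those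
points (`exists_tail_of_tangents`). The Schatten norm is itself convex and `O(1/√n)`-Lipschitz in
the `X_j`, so it concentrates. Its typical size `n^(1/(2(d-1)))` comes from a net bound `O(√n)` on
the operator norm of `X_j - E X_j` and from the hypothesis on the means, whose exponent is exactly
the one that gives this order.

With `L` of order `1 + t^((d-1)/d)/√n`, both the probability of a slope above `L` and the
subgaussian tail `exp(-κ t²/L²)` are controlled by `min {t², n t^(2/d)}`
(`exists_tailBound_posPartTrace`). The centre obtained depends on `L`, hence on `t`;
`exists_tailBound_of_centres` merges the centres, a union bound over boundedly many terms gives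
`Z_P`, and integrating the tail moves the centre to the mean. -/

/-! ### Tail bounds with the rate `min {t², n t^(2/d)}`: sums, integrability, change of centre. -/

/-- The exponent `min {t², n t^(2/d)}` of the tail estimates. -/
noncomputable def rate (d n : ℕ) (t : ℝ) : ℝ := min (t ^ 2) (n * t ^ (2 / (d : ℝ)))

/-- The deviations of `Y` from `a` have tails of order `C * exp (-c * rate d n t)`. -/
def TailBound {Ω E : Type*} [MeasurableSpace Ω] [NormedAddCommGroup E] (μ : Measure Ω)
    (Y : Ω → E) (a : E) (d n : ℕ) (C c : ℝ) : Prop :=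
  ∀ t : ℝ, 0 < t → μ.real {ω | t ≤ ‖Y ω - a‖} ≤ C * Real.exp (-c * rate d n t)

lemma rate_nonneg (d n : ℕ) {t : ℝ} (ht : 0 ≤ t) : 0 ≤ rate d n t :=
  le_min (by positivity) (by positivity)

lemma rate_le_sq (d n : ℕ) (t : ℝ) : rate d n t ≤ t ^ 2 := min_le_left _ _

lemma rate_mono (d n : ℕ) {s t : ℝ} (hs : 0 ≤ s) (hst : s ≤ t) : rate d n s ≤ rate d n t := by
  unfold rate; gcongr

/-- Since `2 / d ≤ 2`, dividing `t` by `B` costs at most `B ^ 2` in either term. Hence all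
rescalings of `t` by constants only affect `c`. -/
lemma rate_le_rate_div {d : ℕ} (hd : 1 ≤ d) (n : ℕ) {B t : ℝ} (hB : 1 ≤ B) (ht : 0 ≤ t) :
    rate d n t / B ^ 2 ≤ rate d n (t / B) := by
  have hB0 : 0 < B := by linarith
  have hd' : (1 : ℝ) ≤ d := by exact_mod_cast hd
  unfold rate
  refine le_min ?_ ?_
  · rw [div_pow]; gcongr; exact min_le_left _ _
  · have h1 : B ^ (2 / (d : ℝ)) ≤ B ^ 2 := by
      rw [← Real.rpow_natCast B 2]
      refine Real.rpow_le_rpow_of_exponent_le hB ?_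
      push_cast
      exact div_le_self (by norm_num) hd'
    have h2 : (0 : ℝ) < B ^ (2 / (d : ℝ)) := by positivity
    calc min (t ^ 2) (n * t ^ (2 / (d : ℝ))) / B ^ 2 ≤ n * t ^ (2 / (d : ℝ)) / B ^ 2 := by
          gcongr; exact min_le_right _ _
      _ ≤ n * t ^ (2 / (d : ℝ)) / B ^ (2 / (d : ℝ)) := by gcongr
      _ = n * (t / B) ^ (2 / (d : ℝ)) := by rw [Real.div_rpow ht hB0.le]; ring

/-- Makes subgaussian tails the case `d = n = 1` of `TailBound`. -/
lemma rate_one_one (t : ℝ) : rate 1 1 t = t ^ 2 := by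
  simp only [rate, Nat.cast_one, div_one, one_mul]
  rw [show (2 : ℝ) = ((2 : ℕ) : ℝ) by norm_num, Real.rpow_natCast, min_self]

/-- A bound on the tails for large `t` extends to all `t`, at the price of the constant. -/
lemma TailBound.of_large {Ω E : Type*} [MeasurableSpace Ω] [NormedAddCommGroup E] {μ : Measure Ω}
    [IsProbabilityMeasure μ] {Y : Ω → E} {a : E} {d n : ℕ} {C c T : ℝ} (hC : 0 ≤ C) (hc : 0 ≤ c)
    (h : ∀ t : ℝ, 0 < t → T ≤ t →
      μ.real {ω | t ≤ ‖Y ω - a‖} ≤ C * Real.exp (-c * rate d n t)) :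
    TailBound μ Y a d n (C + Real.exp (c * T ^ 2)) c := by
  intro t ht
  rcases le_or_gt T t with hT | hT
  · refine (h t ht hT).trans ?_
    gcongr
    linarith [Real.exp_pos (c * T ^ 2)]
  · calc μ.real {ω | t ≤ ‖Y ω - a‖} ≤ 1 := measureReal_le_one
      _ ≤ Real.exp (c * T ^ 2) * Real.exp (-c * rate d n t) := by
          rw [← Real.exp_add, Real.one_le_exp_iff]
          have h1 : rate d n t ≤ T ^ 2 :=
            (rate_le_sq d n t).trans (by gcongr)
          nlinarith [mul_le_mul_of_nonneg_left h1 hc]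
      _ ≤ _ := by gcongr; linarith

lemma TailBound.weaken {Ω E : Type*} [MeasurableSpace Ω] [NormedAddCommGroup E] {μ : Measure Ω}
    {Y : Ω → E} {a : E} {d n : ℕ} {C c C' c' : ℝ} (h : TailBound μ Y a d n C c) (hC : C ≤ C')
    (hC' : 0 ≤ C') (hc : c' ≤ c) : TailBound μ Y a d n C' c' := by
  intro t ht
  refine (h t ht).trans ?_
  have := rate_nonneg d n ht.le
  have h1 : Real.exp (-c * rate d n t) ≤ Real.exp (-c' * rate d n t) := by
    apply Real.exp_le_exp.2; nlinarith
  calc _ ≤ C' * Real.exp (-c * rate d n t) := by gcongr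
    _ ≤ _ := by gcongr

/-- Linear combinations with coefficients of modulus at most one. -/
lemma TailBound.sum {Ω ι : Type*} [MeasurableSpace Ω] {μ : Measure Ω}
    [IsProbabilityMeasure μ] {d n B : ℕ} (hd : 1 ≤ d) (hB : 1 ≤ B) {C c : ℝ} (hC : 0 ≤ C)
    (hc : 0 ≤ c) (s : Finset ι) (hs : s.card ≤ B) (Y : ι → Ω → ℂ) (a b : ι → ℂ)
    (hb : ∀ i ∈ s, ‖b i‖ ≤ 1) (h : ∀ i ∈ s, TailBound μ (Y i) (a i) d n C c) :
    TailBound μ (fun ω => ∑ i ∈ s, b i * Y i ω) (∑ i ∈ s, b i * a i) d n (B * C) (c / B ^ 2) := by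
  intro t ht
  have hB' : (1 : ℝ) ≤ B := by exact_mod_cast hB
  have hB0 : (0 : ℝ) < B := by linarith
  have hsub : {ω | t ≤ ‖∑ i ∈ s, b i * Y i ω - ∑ i ∈ s, b i * a i‖}
      ⊆ ⋃ i ∈ s, {ω | t / B ≤ ‖Y i ω - a i‖} := by
    intro ω hω
    simp only [Set.mem_ofPred_eq, Set.mem_iUnion, exists_prop] at hω ⊢
    by_contra! hcon
    rw [← Finset.sum_sub_distrib] at hω
    have hle : ∀ i ∈ s, ‖b i * Y i ω - b i * a i‖ ≤ ‖Y i ω - a i‖ := by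
      intro i hi
      rw [← mul_sub, norm_mul]
      exact mul_le_of_le_one_left (norm_nonneg _) (hb i hi)
    rcases s.eq_empty_or_nonempty with rfl | hne
    · simp at hω; linarith
    · have h1 : ‖∑ i ∈ s, (b i * Y i ω - b i * a i)‖ < ∑ _i ∈ s, t / B :=
        (norm_sum_le _ _).trans_lt (Finset.sum_lt_sum_of_nonempty hne
          fun i hi => (hle i hi).trans_lt (hcon i hi))
      rw [Finset.sum_const, nsmul_eq_mul] at h1
      have h2 : (s.card : ℝ) * (t / B) ≤ B * (t / B) := by gcongr
      rw [mul_div_cancel₀ _ hB0.ne'] at h2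
      linarith
  calc μ.real _ ≤ μ.real (⋃ i ∈ s, {ω | t / B ≤ ‖Y i ω - a i‖}) := measureReal_mono hsub (measure_ne_top _ _)
    _ ≤ ∑ i ∈ s, μ.real {ω | t / B ≤ ‖Y i ω - a i‖} := measureReal_biUnion_finset_le _ _
    _ ≤ ∑ _i ∈ s, C * Real.exp (-c * rate d n (t / B)) :=
        Finset.sum_le_sum fun i hi => h i hi _ (by positivity)
    _ = s.card * (C * Real.exp (-c * rate d n (t / B))) := by
        rw [Finset.sum_const, nsmul_eq_mul]
    _ ≤ B * (C * Real.exp (-(c / B ^ 2) * rate d n t)) := by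
        have h1 := mul_le_mul_of_nonneg_left (rate_le_rate_div hd n hB' ht.le) hc
        have h2 : -c * rate d n (t / B) ≤ -(c / B ^ 2) * rate d n t := by
          have : c * (rate d n t / B ^ 2) = c / B ^ 2 * rate d n t := by ring
          linarith
        gcongr
    _ = _ := by ring

/-- The integral of the tail function. -/
noncomputable def tailIntegral (d : ℕ) (C c : ℝ) : ℝ :=
  ∫ t in Set.Ioi (0 : ℝ), C * (Real.exp (-c * t ^ (2 : ℝ)) + Real.exp (-c * t ^ (2 / (d : ℝ))))

lemma integrableOn_tail {d : ℕ} (hd : 1 ≤ d) {C c : ℝ} (hc : 0 < c) :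
    IntegrableOn (fun t : ℝ => C * (Real.exp (-c * t ^ (2 : ℝ)) + Real.exp (-c * t ^ (2 / (d : ℝ)))))
      (Set.Ioi 0) := by
  have hd' : (0 : ℝ) < d := by exact_mod_cast hd
  have h1 := integrableOn_rpow_mul_exp_neg_mul_rpow (p := 2) (s := 0) (b := c)
    (by norm_num) (by norm_num) hc
  have h2 := integrableOn_rpow_mul_exp_neg_mul_rpow (p := 2 / (d : ℝ)) (s := 0) (b := c)
    (by norm_num) (by positivity) hc
  simp only [Real.rpow_zero, one_mul] at h1 h2
  exact (h1.add h2).const_mul C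

/-- Layer-cake formula. For `n ≥ 1` the exponential of the minimum is at most the sum of the two
exponentials with `n` dropped, so the bound is uniform in `n`. -/
lemma TailBound.integrable_and_norm_sub_le {Ω E : Type*} [MeasurableSpace Ω]
    [NormedAddCommGroup E] [NormedSpace ℝ E] [CompleteSpace E] {μ : Measure Ω}
    [IsProbabilityMeasure μ] {Y : Ω → E} (hY : AEStronglyMeasurable Y μ) {a : E} {d n : ℕ}
    (hd : 1 ≤ d) (hn : 1 ≤ n) {C c : ℝ} (hC : 0 ≤ C) (hc : 0 < c) (h : TailBound μ Y a d n C c) :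
    Integrable Y μ ∧ ‖∫ ω, Y ω ∂μ - a‖ ≤ tailIntegral d C c := by
  have hYa : AEStronglyMeasurable (fun ω => Y ω - a) μ := hY.sub aestronglyMeasurable_const
  have hnn : 0 ≤ tailIntegral d C c :=
    setIntegral_nonneg measurableSet_Ioi fun t _ => by positivity
  have hlin : ∫⁻ ω, ENNReal.ofReal ‖Y ω - a‖ ∂μ ≤ ENNReal.ofReal (tailIntegral d C c) := by
    rw [lintegral_eq_lintegral_meas_le μ (Filter.Eventually.of_forall fun _ => norm_nonneg _)
      hYa.norm.aemeasurable, tailIntegral,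
      ofReal_integral_eq_lintegral_ofReal (integrableOn_tail hd hc)
        (ae_restrict_of_forall_mem measurableSet_Ioi fun t _ => by positivity)]
    refine setLIntegral_mono' measurableSet_Ioi fun t ht => ?_
    rw [← ofReal_measureReal]
    refine ENNReal.ofReal_le_ofReal ((h t ht).trans ?_)
    have ht0 : (0 : ℝ) < t := ht
    gcongr
    have h1 : t ^ (2 / (d : ℝ)) ≤ n * t ^ (2 / (d : ℝ)) :=
      le_mul_of_one_le_left (by positivity) (by exact_mod_cast hn)
    unfold rate
    rcases min_choice (t ^ 2) (n * t ^ (2 / (d : ℝ))) with h2 | h2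
    · rw [h2, show (2 : ℝ) = ((2 : ℕ) : ℝ) by norm_num, Real.rpow_natCast]
      linarith [Real.exp_pos (-c * t ^ (((2 : ℕ) : ℝ) / (d : ℝ)))]
    · rw [h2]
      have h3 : Real.exp (-c * (n * t ^ (2 / (d : ℝ)))) ≤ Real.exp (-c * t ^ (2 / (d : ℝ))) := by
        apply Real.exp_le_exp.2; nlinarith
      linarith [Real.exp_pos (-c * t ^ (2 : ℝ))]
  have hint : Integrable (fun ω => Y ω - a) μ := by
    refine ⟨hYa, ?_⟩
    rw [hasFiniteIntegral_iff_norm]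
    exact hlin.trans_lt ENNReal.ofReal_lt_top
  have hYi : Integrable Y μ := by
    simpa [Pi.add_def] using hint.add (integrable_const a)
  refine ⟨hYi, ?_⟩
  have : ∫ ω, Y ω ∂μ - a = ∫ ω, (Y ω - a) ∂μ := by
    rw [integral_sub hYi (integrable_const a)]; simp
  rw [this]
  refine (norm_integral_le_integral_norm _).trans ?_
  rw [integral_eq_lintegral_of_nonneg_ae (Filter.Eventually.of_forall fun _ => norm_nonneg _)
    hYa.norm]
  exact ENNReal.toReal_le_of_le_ofReal hnn hlin

/-- Tails about some point give integrability and tails about the mean. -/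
lemma TailBound.about_mean {Ω E : Type*} [MeasurableSpace Ω]
    [NormedAddCommGroup E] [NormedSpace ℝ E] [CompleteSpace E] {μ : Measure Ω}
    [IsProbabilityMeasure μ] {Y : Ω → E} (hY : AEStronglyMeasurable Y μ) {a : E} {d n : ℕ}
    (hd : 1 ≤ d) (hn : 1 ≤ n) {C c : ℝ} (hC : 0 ≤ C) (hc : 0 < c) (h : TailBound μ Y a d n C c) :
    TailBound μ Y (∫ ω, Y ω ∂μ) d n
      (C + Real.exp (c / 4 * (2 * tailIntegral d C c) ^ 2)) (c / 4) := by
  obtain ⟨-, hI⟩ := h.integrable_and_norm_sub_le hY hd hn hC hc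
  -- Beyond twice the tail integral the mean is within `t / 2` of `a`.
  refine TailBound.of_large hC (by positivity) fun t ht hT => ?_
  have hsub : {ω | t ≤ ‖Y ω - ∫ ω, Y ω ∂μ‖} ⊆ {ω | t / 2 ≤ ‖Y ω - a‖} := by
    intro ω hω
    simp only [Set.mem_ofPred_eq] at hω ⊢
    have := norm_sub_le_norm_sub_add_norm_sub (Y ω) a (∫ ω, Y ω ∂μ)
    rw [norm_sub_rev a] at this
    linarith
  refine (measureReal_mono hsub).trans ((h _ (by positivity)).trans ?_)
  have h1 := rate_le_rate_div hd n (B := 2) (by norm_num) ht.le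
  refine mul_le_mul_of_nonneg_left (Real.exp_le_exp.2 ?_) hC
  nlinarith

/-- The radius beyond which the centres of different tail estimates have to be close. -/
noncomputable def centreRadius (d : ℕ) (C c : ℝ) : ℝ := (max 1 (Real.log (4 * C) / c)) ^ d

/-- Tail estimates with centres that depend on `t` give tail estimates with one centre. -/
lemma exists_tailBound_of_centres {Ω E : Type*} [MeasurableSpace Ω] [NormedAddCommGroup E]
    {μ : Measure Ω} [IsProbabilityMeasure μ] {Y : Ω → E} {d n : ℕ} (hd : 1 ≤ d) (hn : 1 ≤ n)
    {C c : ℝ} (hC : 0 < C) (hc : 0 < c)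
    (h : ∀ t : ℝ, 0 < t → ∃ a, μ.real {ω | t ≤ ‖Y ω - a‖} ≤ C * Real.exp (-c * rate d n t)) :
    ∃ a, TailBound μ Y a d n (C + Real.exp (c / 9 * (3 * centreRadius d C c) ^ 2)) (c / 9) := by
  set M : ℝ := max 1 (Real.log (4 * C) / c) with hM
  have hM1 : 1 ≤ M := le_max_left _ _
  have hT : centreRadius d C c = M ^ d := rfl
  rw [hT]
  have hT1 : 1 ≤ M ^ d := one_le_pow₀ hM1
  have hn' : (1 : ℝ) ≤ n := by exact_mod_cast hn
  have hd0 : (d : ℝ) ≠ 0 := by positivity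
  -- The radius is a `d`-th power because `(M ^ d) ^ (2 / d) = M ^ 2`. Both terms of the rate are
  -- then at least `M`, and `c * M ≥ log (4 * C)` makes the tail at most `1 / 4`.
  have hrate : M ≤ rate d n (M ^ d) := by
    refine le_min ?_ ?_
    · rw [← pow_mul]; exact le_self_pow₀ hM1 (by positivity)
    · have : (M ^ d) ^ (2 / (d : ℝ)) = M ^ 2 := by
        rw [← Real.rpow_natCast, ← Real.rpow_mul (by linarith), ← Real.rpow_natCast M 2]
        congr 1; push_cast; field_simp
      rw [this]; nlinarith
  have hsmall : ∀ t, M ^ d ≤ t → C * Real.exp (-c * rate d n t) ≤ 1 / 4 := by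
    intro t ht
    have h1 : M ≤ rate d n t := hrate.trans (rate_mono d n (by linarith) ht)
    have h2 : Real.log (4 * C) ≤ c * rate d n t := by
      have : Real.log (4 * C) / c ≤ rate d n t := (le_max_right _ _).trans h1
      rw [div_le_iff₀ hc] at this; linarith
    have h3 : Real.exp (-c * rate d n t) ≤ Real.exp (-Real.log (4 * C)) :=
      Real.exp_le_exp.2 (by linarith)
    rw [Real.exp_neg, Real.exp_log (by positivity)] at h3
    calc _ ≤ C * (4 * C)⁻¹ := by gcongr
      _ = 1 / 4 := by field_simp
  obtain ⟨a, ha⟩ := h (M ^ d) (by linarith)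
  refine ⟨a, TailBound.of_large hC.le (by positivity) fun t ht hTt => ?_⟩
  obtain ⟨b, hb⟩ := h (t / 3) (by positivity)
  have hTt' : M ^ d ≤ t / 3 := by linarith
  -- Two events of probability at most `1 / 4` cannot cover the space; an outcome outside both
  -- forces the two centres to be close.
  have hex : ∃ ω, ω ∉ {ω | M ^ d ≤ ‖Y ω - a‖} ∪ {ω | t / 3 ≤ ‖Y ω - b‖} := by
    by_contra! hcon
    have h1 : μ.real ({ω | M ^ d ≤ ‖Y ω - a‖} ∪ {ω | t / 3 ≤ ‖Y ω - b‖}) = 1 := by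
      rw [Set.eq_univ_of_forall hcon, probReal_univ]
    have h2 := measureReal_union_le (μ := μ) {ω | M ^ d ≤ ‖Y ω - a‖} {ω | t / 3 ≤ ‖Y ω - b‖}
    have h3 := hsmall _ le_rfl
    have h4 := hsmall _ hTt'
    linarith
  obtain ⟨ω₀, hω₀⟩ := hex
  simp only [Set.mem_union, Set.mem_ofPred_eq, not_or, not_le] at hω₀
  have hab : ‖b - a‖ ≤ 2 * (t / 3) := by
    have := norm_sub_le_norm_sub_add_norm_sub b (Y ω₀) a
    rw [norm_sub_rev b (Y ω₀)] at this
    linarith [hω₀.1, hω₀.2]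
  have hsub : {ω | t ≤ ‖Y ω - a‖} ⊆ {ω | t / 3 ≤ ‖Y ω - b‖} := by
    intro ω hω
    simp only [Set.mem_ofPred_eq] at hω ⊢
    have := norm_sub_le_norm_sub_add_norm_sub (Y ω) b a
    linarith
  refine (measureReal_mono hsub).trans (hb.trans ?_)
  have h1 := rate_le_rate_div hd n (B := 3) (by norm_num) ht.le
  refine mul_le_mul_of_nonneg_left (Real.exp_le_exp.2 ?_) hC.le
  nlinarith

/-! ### Convex concentration about means: truncation by tangents and product measures. -/

/-- Subgaussian concentration about the mean for convex `1`-Lipschitz functions. -/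
def MeanConcentration {V : Type*} [NormedAddCommGroup V] [NormedSpace ℝ V] [MeasurableSpace V]
    (ν : Measure V) (K κ : ℝ) : Prop :=
  ∀ f : V → ℝ, ConvexOn ℝ Set.univ f → LipschitzWith 1 f → TailBound ν f (∫ x, f x ∂ν) 1 1 K κ

/-- The multiplicative constant in the passage from medians to means. -/
noncomputable def meanConstant (K κ : ℝ) : ℝ :=
  K + Real.exp (κ / 4 * (2 * tailIntegral 1 K κ) ^ 2)

lemma meanConstant_pos {K κ : ℝ} (hK : 0 ≤ K) : 0 < meanConstant K κ := by
  unfold meanConstant; positivity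

/-- Means replace medians because integrating out one variable preserves convexity and Lipschitz
constants, which is what tensorization in `prod` needs. -/
lemma ConvexConcentration.meanConcentration {Ω V : Type*} [MeasurableSpace Ω] {μ : Measure Ω}
    [IsProbabilityMeasure μ] [NormedAddCommGroup V] [NormedSpace ℝ V] [MeasurableSpace V]
    [BorelSpace V] {X : Ω → V} (hX : Measurable X) {K κ : ℝ} (hK : 0 ≤ K) (hκ : 0 < κ)
    (h : ConvexConcentration μ X K κ) :
    MeanConcentration (μ.map X) (meanConstant K κ) (κ / 4) := by
  intro f hf hL
  obtain ⟨M, -, hM⟩ := h f hf hL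
  have hfm : Measurable f := hL.continuous.measurable
  have := Measure.isProbabilityMeasure_map (μ := μ) hX.aemeasurable
  refine TailBound.about_mean (a := M) hL.continuous.aestronglyMeasurable le_rfl le_rfl hK hκ ?_
  intro t ht
  have hms : MeasurableSet {x | t ≤ ‖f x - M‖} :=
    measurableSet_le measurable_const (hfm.sub_const M).norm
  rw [map_measureReal_apply hX hms, rate_one_one]
  exact hM t ht

namespace MeanConcentration

lemma mono {V : Type*} [NormedAddCommGroup V] [NormedSpace ℝ V] [MeasurableSpace V]
    {ν : Measure V} {K κ : ℝ} (h : MeanConcentration ν K κ) {K' κ' : ℝ} (hK : K ≤ K') (hK' : 0 ≤ K') (hκ : κ' ≤ κ) :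
    MeanConcentration ν K' κ' :=
  fun f hf hL => (h f hf hL).weaken hK hK' hκ

lemma map {V : Type*} [NormedAddCommGroup V] [NormedSpace ℝ V] [MeasurableSpace V]
    {ν : Measure V} {K κ : ℝ} (h : MeanConcentration ν K κ) {V' : Type*} [NormedAddCommGroup V'] [NormedSpace ℝ V']
    [MeasurableSpace V'] [BorelSpace V'] (T : V →ₗ[ℝ] V') (hT : LipschitzWith 1 T)
    (hTm : Measurable T) :
    MeanConcentration (ν.map T) K κ := by
  intro f hf hL t ht
  have hfm : Measurable f := hL.continuous.measurable
  have hms (a : ℝ) : MeasurableSet {x | t ≤ ‖f x - a‖} :=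
    measurableSet_le measurable_const (hfm.sub_const a).norm
  rw [map_measureReal_apply hTm (hms _),
    integral_map hTm.aemeasurable hL.continuous.aestronglyMeasurable]
  have h1 : ConvexOn ℝ Set.univ (f ∘ T) := hf.comp_linearMap T
  have h2 : LipschitzWith 1 (f ∘ T) := by simpa using hL.comp hT
  exact h (f ∘ T) h1 h2 t ht

variable {V : Type*} [NormedAddCommGroup V] [NormedSpace ℝ V] [MeasurableSpace V] [BorelSpace V]
  {ν : Measure V} [IsProbabilityMeasure ν] {K κ : ℝ}

lemma integrable (h : MeanConcentration ν K κ) (hK : 0 ≤ K) (hκ : 0 < κ) {f : V → ℝ}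
    (hf : ConvexOn ℝ Set.univ f) {L : ℝ} (hL : 0 < L) (hfL : ∀ x y, f x - f y ≤ L * ‖x - y‖) :
    Integrable f ν ∧
      ∀ t, 0 < t → ν.real {x | t ≤ |f x - ∫ y, f y ∂ν|} ≤ K * Real.exp (-κ * (t / L) ^ 2) := by
  set g : V → ℝ := fun x => L⁻¹ * f x with hg
  have hgc : ConvexOn ℝ Set.univ g := by
    simpa [hg, Pi.smul_def] using hf.smul (c := L⁻¹) (by positivity)
  have hgL : LipschitzWith 1 g := by
    refine LipschitzWith.of_le_add_mul 1 fun x y => ?_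
    have := hfL x y
    simp only [hg, NNReal.coe_one, one_mul, dist_eq_norm]
    rw [inv_mul_le_iff₀ hL, mul_add, mul_inv_cancel_left₀ hL.ne']
    linarith
  have hfg : f = fun x => L * g x := by
    ext x; simp only [hg]; rw [mul_inv_cancel_left₀ hL.ne']
  have hgi := (TailBound.integrable_and_norm_sub_le
    hgL.continuous.aestronglyMeasurable le_rfl le_rfl hK hκ (h g hgc hgL)).1
  refine ⟨by rw [hfg]; exact hgi.const_mul L, fun t ht => ?_⟩
  have h1 := h g hgc hgL (t / L) (by positivity)
  rw [rate_one_one] at h1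
  convert h1 using 3
  ext x
  have : f x - ∫ y, f y ∂ν = L * (g x - ∫ y, g y ∂ν) := by
    rw [mul_sub, ← integral_const_mul]; simp [hfg]
  rw [this, abs_mul, abs_of_pos hL, Real.norm_eq_abs, div_le_iff₀' hL]

lemma integrable_of_lipschitz (h : MeanConcentration ν K κ) (hK : 0 ≤ K) (hκ : 0 < κ) {f : V → ℝ}
    (hf : ConvexOn ℝ Set.univ f) (hL : LipschitzWith 1 f) : Integrable f ν :=
  (TailBound.integrable_and_norm_sub_le
    hL.continuous.aestronglyMeasurable le_rfl le_rfl hK hκ (h f hf hL)).1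

lemma integrable_norm (h : MeanConcentration ν K κ) (hK : 0 ≤ K) (hκ : 0 < κ) :
    Integrable (fun x : V => ‖x‖) ν :=
  h.integrable_of_lipschitz hK hκ convexOn_univ_norm lipschitzWith_one_norm

/-- Tangent functions of controlled slope give concentration about some centre, up to the
probability that the slope is large. -/
lemma exists_tail_of_tangents (h : MeanConcentration ν K κ) (hK : 0 ≤ K) (hκ : 0 < κ)
    (F S : V → ℝ) (G : V → V → ℝ) (hGF : ∀ x y, G x y ≤ F y) (hGx : ∀ x, G x x = F x)
    (hGc : ∀ x, ConvexOn ℝ Set.univ (G x)) (hGL : ∀ x y z, G x y - G x z ≤ S x * ‖y - z‖)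
    {L : ℝ} (hL : 0 < L) :
    ∃ a, ∀ t, 0 < t → ν.real {x | t ≤ |F x - a|} ≤
      ν.real {x | L < S x} + K * Real.exp (-κ * (t / L) ^ 2) := by
  rcases isEmpty_or_nonempty {x // S x ≤ L} with hemp | hne
  -- With no point of slope at most `L`, the first probability on the right is already `1`.
  · refine ⟨0, fun t _ => ?_⟩
    have : {x | L < S x} = Set.univ := by
      ext x
      simp only [Set.mem_ofPred_eq, Set.mem_univ, iff_true]
      by_contra hx
      exact hemp.elim ⟨x, not_lt.1 hx⟩
    rw [this, probReal_univ]
    have : ν.real {x | t ≤ |F x - 0|} ≤ 1 := measureReal_le_one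
    have : 0 ≤ K * Real.exp (-κ * (t / L) ^ 2) := by positivity
    linarith
  -- Lipschitz truncation that keeps convexity: the supremum of the tangents based at points of
  -- slope at most `L`. It lies below `F` and equals `F` at those points.
  · set f : V → ℝ := fun y => ⨆ x : {x // S x ≤ L}, G x y with hf
    have hbdd : ∀ y, BddAbove (Set.range fun x : {x // S x ≤ L} => G x y) := fun y =>
      ⟨F y, by rintro _ ⟨x, rfl⟩; exact hGF x y⟩
    have hfc : ConvexOn ℝ Set.univ f := by
      refine ⟨convex_univ, fun y _ z _ a b ha hb hab => ?_⟩
      refine ciSup_le fun x => ((hGc x).2 (Set.mem_univ y) (Set.mem_univ z) ha hb hab).trans ?_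
      simp only [smul_eq_mul]
      gcongr
      · exact le_ciSup (hbdd y) x
      · exact le_ciSup (hbdd z) x
    have hfL : ∀ y z, f y - f z ≤ L * ‖y - z‖ := by
      intro y z
      rw [sub_le_iff_le_add]
      refine ciSup_le fun x => ?_
      have h1 := hGL x y z
      have h2 : G x z ≤ f z := le_ciSup (hbdd z) x
      have h3 : S x * ‖y - z‖ ≤ L * ‖y - z‖ := by
        gcongr; exact x.2
      linarith
    have hfF : ∀ x, S x ≤ L → f x = F x := fun x hx =>
      le_antisymm (ciSup_le fun y => hGF y x)
        ((hGx x).symm.le.trans (le_ciSup (hbdd x) ⟨x, hx⟩))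
    refine ⟨∫ y, f y ∂ν, fun t ht => ?_⟩
    refine le_trans ?_ (add_le_add le_rfl ((h.integrable hK hκ hfc hL hfL).2 t ht))
    refine (measureReal_mono ?_).trans (measureReal_union_le _ _)
    intro x hx
    by_cases hS : S x ≤ L
    · right
      simpa only [Set.mem_ofPred_eq, hfF x hS] using hx
    · left
      exact not_le.1 hS

/-- Let `g` integrate out the second variable. In `f - E f = (f - g) + (g - E g)` the first term is
controlled section by section by `ν'`, the second by `ν`; if the sum reaches `t`, one of them
reaches `t / 2`, whence `2 * K` and `κ / 4`. -/
lemma prod [SecondCountableTopology V] (h : MeanConcentration ν K κ) (hK : 0 ≤ K) (hκ : 0 < κ)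
    {V' : Type*} [NormedAddCommGroup V']
    [NormedSpace ℝ V'] [MeasurableSpace V'] [BorelSpace V'] [SecondCountableTopology V']
    {ν' : Measure V'} [IsProbabilityMeasure ν'] (h' : MeanConcentration ν' K κ) :
    MeanConcentration (ν.prod ν') (2 * K) (κ / 4) := by
  intro f hf hL t ht
  rw [rate_one_one]
  have hfm : Measurable f := hL.continuous.measurable
  have hc : ∀ x, ConvexOn ℝ Set.univ fun y => f (x, y) := by
    intro x
    refine ⟨convex_univ, fun y _ z _ a b ha hb hab => ?_⟩
    have := hf.2 (Set.mem_univ (x, y)) (Set.mem_univ (x, z)) ha hb hab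
    simpa [← add_smul, hab] using this
  have hl : ∀ x, LipschitzWith 1 fun y => f (x, y) := by
    intro x
    simpa [Function.comp_def] using hL.comp (LipschitzWith.prodMk_left x)
  have hi : ∀ x, Integrable (fun y => f (x, y)) ν' := fun x =>
    h'.integrable_of_lipschitz hK hκ (hc x) (hl x)
  set g : V → ℝ := fun x => ∫ y, f (x, y) ∂ν' with hg
  have hgc : ConvexOn ℝ Set.univ g := by
    refine ⟨convex_univ, fun x _ z _ a b ha hb hab => ?_⟩
    simp only [hg, smul_eq_mul]
    rw [← integral_const_mul, ← integral_const_mul,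
      ← integral_add ((hi x).const_mul a) ((hi z).const_mul b)]
    refine integral_mono (hi _) (((hi x).const_mul a).add ((hi z).const_mul b)) fun y => ?_
    have := hf.2 (Set.mem_univ (x, y)) (Set.mem_univ (z, y)) ha hb hab
    simpa [← add_smul, hab] using this
  have hgl : LipschitzWith 1 g := by
    refine LipschitzWith.of_le_add_mul 1 fun x z => ?_
    simp only [hg, NNReal.coe_one, one_mul]
    have h1 : ∫ y, f (x, y) ∂ν' ≤ ∫ y, (f (z, y) + dist x z) ∂ν' := by
      refine integral_mono (hi x) ((hi z).add (integrable_const _)) fun y => ?_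
      have := hL.dist_le_mul (x, y) (z, y)
      simp only [NNReal.coe_one, one_mul, Prod.dist_eq, dist_self, Real.dist_eq] at this
      rw [max_eq_left dist_nonneg] at this
      have := le_abs_self (f (x, y) - f (z, y))
      simp only
      linarith
    rwa [integral_add (hi z) (integrable_const _), integral_const, probReal_univ, one_smul] at h1
  have hfi : Integrable f (ν.prod ν') := by
    have h1 : Integrable (fun p : V × V' => ‖p.1‖ + ‖p.2‖ + ‖f 0‖) (ν.prod ν') :=
      (((h.integrable_norm hK hκ).comp_fst ν').add ((h'.integrable_norm hK hκ).comp_snd ν)).add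
        (integrable_const _)
    refine h1.mono' hfm.aestronglyMeasurable (Filter.Eventually.of_forall fun p => ?_)
    have h2 := hL.dist_le_mul p 0
    simp only [NNReal.coe_one, one_mul, dist_zero_right, Real.dist_eq] at h2
    have h3 : ‖p‖ ≤ ‖p.1‖ + ‖p.2‖ := by
      rw [Prod.norm_def]
      exact max_le_add_of_nonneg (norm_nonneg _) (norm_nonneg _)
    have h4 : ‖f p‖ ≤ ‖f p - f 0‖ + ‖f 0‖ := by
      simpa using norm_add_le (f p - f 0) (f 0)
    rw [Real.norm_eq_abs (f p - f 0)] at h4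
    linarith
  have hint : ∫ p, f p ∂(ν.prod ν') = ∫ x, g x ∂ν := integral_prod f hfi
  rw [hint]
  set A : Set (V × V') := {p | t / 2 ≤ ‖f p - g p.1‖} with hA
  set B : Set V := {x | t / 2 ≤ ‖g x - ∫ y, g y ∂ν‖} with hB
  have hgm : Measurable g := hgl.continuous.measurable
  have hAm : MeasurableSet A :=
    measurableSet_le measurable_const (hfm.sub (hgm.comp measurable_fst)).norm
  have hsub : {p | t ≤ ‖f p - ∫ x, g x ∂ν‖} ⊆ A ∪ B ×ˢ Set.univ := by
    intro p hp
    simp only [Set.mem_ofPred_eq, hA, hB, Set.mem_union, Set.mem_prod, Set.mem_univ,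
      and_true] at hp ⊢
    by_contra! hcon
    have := norm_sub_le_norm_sub_add_norm_sub (f p) (g p.1) (∫ x, g x ∂ν)
    linarith [hcon.1, hcon.2]
  have hApr : (ν.prod ν').real A ≤ K * Real.exp (-κ * (t / 2) ^ 2) := by
    refine ENNReal.toReal_le_of_le_ofReal (by positivity) ?_
    rw [Measure.prod_apply hAm]
    calc ∫⁻ x, ν' (Prod.mk x ⁻¹' A) ∂ν
        ≤ ∫⁻ _x, ENNReal.ofReal (K * Real.exp (-κ * (t / 2) ^ 2)) ∂ν := by
          refine lintegral_mono fun x => ?_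
          rw [← ofReal_measureReal]
          refine ENNReal.ofReal_le_ofReal ?_
          have := h' _ (hc x) (hl x) (t / 2) (by positivity)
          rwa [rate_one_one] at this
      _ = _ := by simp
  have hBpr : (ν.prod ν').real (B ×ˢ Set.univ) ≤ K * Real.exp (-κ * (t / 2) ^ 2) := by
    rw [measureReal_prod_prod, probReal_univ, mul_one]
    have := h g hgc hgl (t / 2) (by positivity)
    rwa [rate_one_one] at this
  calc _ ≤ (ν.prod ν').real (A ∪ B ×ˢ Set.univ) := measureReal_mono hsub
    _ ≤ _ := measureReal_union_le _ _
    _ ≤ _ := add_le_add hApr hBpr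
    _ = 2 * K * Real.exp (-(κ / 4) * t ^ 2) := by
      rw [show -κ * (t / 2) ^ 2 = -(κ / 4) * t ^ 2 by ring]; ring

/-- Finite products. -/
lemma pi {V : Type*} [NormedAddCommGroup V] [NormedSpace ℝ V] [MeasurableSpace V] [BorelSpace V]
    [SecondCountableTopology V] {K κ : ℝ} (hK : 0 ≤ K) (hκ : 0 < κ) :
    ∀ (m : ℕ) (ν : Fin m → Measure V) (_ : ∀ j, IsProbabilityMeasure (ν j))
      (_ : ∀ j, MeanConcentration (ν j) K κ),
      MeanConcentration (Measure.pi ν) (2 ^ m * K) (κ / 4 ^ m) := by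
  intro m
  induction m with
  | zero =>
    intro ν _ _ f hf hL t ht
    have h1 : ∀ x : Fin 0 → V, f x = f 0 := fun x => by rw [Subsingleton.elim x 0]
    have : {x | t ≤ ‖f x - ∫ x, f x ∂(Measure.pi ν)‖} = ∅ := by
      ext x
      simp only [Set.mem_ofPred_eq, Set.mem_empty_iff_false, iff_false, not_le]
      rw [integral_congr_ae (Filter.Eventually.of_forall h1), h1 x]
      simpa using ht
    rw [this]
    simp only [measureReal_empty]
    positivity
  | succ m ih =>
    intro ν hν h
    have h1 := ih (fun j => ν j.succ) (fun j => hν _) fun j => h _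
    -- The first factor is given the weaker constants of the other `m`, since `prod` takes a common
    -- pair.
    have h0 := (h 0).mono (K' := 2 ^ m * K) (κ' := κ / 4 ^ m)
      (le_mul_of_one_le_left hK (one_le_pow₀ (by norm_num))) (by positivity)
      (div_le_self hκ.le (one_le_pow₀ (by norm_num)))
    have h2 := h0.prod (by positivity) (by positivity) h1
    let T : V × (Fin m → V) →ₗ[ℝ] (Fin (m + 1) → V) :=
      { toFun := fun p => Fin.cons p.1 p.2
        map_add' := fun p q => by
          ext j; refine Fin.cases ?_ (fun i => ?_) j <;> simp
        map_smul' := fun c p => by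
          ext j; refine Fin.cases ?_ (fun i => ?_) j <;> simp }
    have hTapp : ∀ p, T p = Fin.cons p.1 p.2 := fun _ => rfl
    have hT : LipschitzWith 1 T := by
      refine LipschitzWith.of_dist_le_mul fun p q => ?_
      rw [NNReal.coe_one, one_mul, dist_pi_le_iff dist_nonneg]
      intro j
      refine Fin.cases ?_ (fun i => ?_) j
      · simp only [hTapp, Fin.cons_zero, Prod.dist_eq]; exact le_max_left _ _
      · simp only [hTapp, Fin.cons_succ, Prod.dist_eq]
        exact (dist_le_pi_dist _ _ _).trans (le_max_right _ _)
    have hTm : Measurable T := hT.continuous.measurable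
    have h3 := h2.map T hT hTm
    have h4 : ((ν 0).prod (Measure.pi fun j => ν j.succ)).map T = Measure.pi ν := by
      have := (measurePreserving_piFinSuccAbove ν 0).symm
      have h5 := this.map_eq
      convert h5 using 2
      · funext p
        exact (Fin.insertNth_zero' p.1 p.2).symm
      · simp only [Fin.zero_succAbove]
    rw [h4] at h3
    convert h3 using 1 <;> ring

end MeanConcentration

/-! ### Peierls' inequality and Schatten norms of Hermitian matrices. -/

namespace Matrix

lemma sum_pow_le_sum_pow {ι : Type*} (s : Finset ι) {a : ι → ℝ} (ha : ∀ i, 0 ≤ a i) {q : ℕ}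
    (hq : 1 ≤ q) : ∑ i ∈ s, a i ^ q ≤ (∑ i ∈ s, a i) ^ q := by
  obtain ⟨k, rfl⟩ := Nat.exists_eq_add_of_le' hq
  rw [pow_succ, Finset.mul_sum]
  refine Finset.sum_le_sum fun i hi => ?_
  rw [pow_succ]
  have := ha i
  gcongr
  exact Finset.single_le_sum (fun j _ => ha j) hi

variable {ι : Type*} [Fintype ι]

open scoped Matrix.Norms.Frobenius in
lemma frobenius_norm_sq (A : Matrix ι ι ℂ) : ‖A‖ ^ 2 = ∑ i, ∑ j, ‖A i j‖ ^ 2 := by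
  rw [frobenius_norm_def, ← Real.sqrt_eq_rpow]
  simp only [show (2 : ℝ) = ((2 : ℕ) : ℝ) by norm_num, Real.rpow_natCast]
  exact Real.sq_sqrt (by positivity)

open scoped Matrix.Norms.Frobenius in
lemma norm_entry_le_frobenius (A : Matrix ι ι ℂ) (i j : ι) : ‖A i j‖ ≤ ‖A‖ := by
  refine le_of_pow_le_pow_left₀ two_ne_zero (norm_nonneg _) ?_
  rw [frobenius_norm_sq]
  calc ‖A i j‖ ^ 2 ≤ ∑ j, ‖A i j‖ ^ 2 :=
        Finset.single_le_sum (f := fun j => ‖A i j‖ ^ 2) (fun _ _ => by positivity)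
          (Finset.mem_univ j)
    _ ≤ _ := Finset.single_le_sum (f := fun i => ∑ j, ‖A i j‖ ^ 2)
          (fun _ _ => by positivity) (Finset.mem_univ i)

/-- The real parts of the diagonal entries of `U* B U`. -/
noncomputable def diagConj (U B : Matrix ι ι ℂ) (i : ι) : ℝ := ((star U * B * U) i i).re

lemma diagConj_add (U A B : Matrix ι ι ℂ) (i : ι) :
    diagConj U (A + B) i = diagConj U A i + diagConj U B i := by
  simp [diagConj, mul_add, add_mul]

lemma diagConj_sub (U A B : Matrix ι ι ℂ) (i : ι) :
    diagConj U (A - B) i = diagConj U A i - diagConj U B i := by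
  simp [diagConj, mul_sub, sub_mul]

lemma diagConj_smul (U A : Matrix ι ι ℂ) (c : ℝ) (i : ι) :
    diagConj U (c • A) i = c * diagConj U A i := by
  simp [diagConj]

variable [DecidableEq ι]

namespace IsHermitian

lemma eq_conj_diagonal {A : Matrix ι ι ℂ} (hA : A.IsHermitian) :
    A = (hA.eigenvectorUnitary : Matrix ι ι ℂ) * diagonal (fun i => (hA.eigenvalues i : ℂ))
      * star (hA.eigenvectorUnitary : Matrix ι ι ℂ) := by
  conv_lhs => rw [hA.spectral_theorem]
  rw [Unitary.conjStarAlgAut_apply]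
  rfl

lemma star_mul_mul_of_eq {A V D : Matrix ι ι ℂ} (h : star V * V = 1)
    (hA : A = V * D * star V) : star V * A * V = D := by
  rw [hA, ← mul_assoc, ← mul_assoc, h, one_mul, mul_assoc, h, mul_one]

lemma pow_of_eq {A V D : Matrix ι ι ℂ} (h : star V * V = 1) (h' : V * star V = 1)
    (hA : A = V * D * star V) (k : ℕ) : A ^ k = V * D ^ k * star V := by
  induction k with
  | zero => simp [h']
  | succ k ih =>
    rw [pow_succ, ih, hA, pow_succ]
    simp only [← mul_assoc]
    rw [mul_assoc (V * D ^ k) (star V) V, h, mul_one]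

lemma diagConj_eigenvectorUnitary {A : Matrix ι ι ℂ} (hA : A.IsHermitian) (i : ι) :
    diagConj hA.eigenvectorUnitary A i = hA.eigenvalues i := by
  have h1 : star (hA.eigenvectorUnitary : Matrix ι ι ℂ) * hA.eigenvectorUnitary = 1 :=
    Unitary.coe_star_mul_self _
  have h2 : star (hA.eigenvectorUnitary : Matrix ι ι ℂ) * A * hA.eigenvectorUnitary
      = diagonal (fun i => (hA.eigenvalues i : ℂ)) := by
    exact star_mul_mul_of_eq h1 hA.eq_conj_diagonal
  rw [diagConj, h2, diagonal_apply_eq, Complex.ofReal_re]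

lemma trace_pow_eq {A : Matrix ι ι ℂ} (hA : A.IsHermitian) (k : ℕ) :
    (A ^ k).trace = ∑ i, (hA.eigenvalues i : ℂ) ^ k := by
  have h1 : star (hA.eigenvectorUnitary : Matrix ι ι ℂ) * hA.eigenvectorUnitary = 1 :=
    Unitary.coe_star_mul_self _
  rw [pow_of_eq h1 (Unitary.coe_mul_star_self _) hA.eq_conj_diagonal k]
  rw [mul_assoc, trace_mul_comm, mul_assoc, h1, mul_one, diagonal_pow, trace_diagonal]
  simp

/-- Peierls' inequality: the diagonal of a Hermitian matrix is majorized by its spectrum. -/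
lemma sum_diagConj_le {B : Matrix ι ι ℂ} (hB : B.IsHermitian) {U : Matrix ι ι ℂ}
    (hU : U ∈ unitaryGroup ι ℂ) {f : ℝ → ℝ} (hf : ConvexOn ℝ Set.univ f) :
    ∑ i, f (diagConj U B i) ≤ ∑ k, f (hB.eigenvalues k) := by
  set V : Matrix ι ι ℂ := (↑hB.eigenvectorUnitary : Matrix ι ι ℂ) with hV
  have hV1 : star V * V = 1 := Unitary.coe_star_mul_self _
  have hV2 : V * star V = 1 := Unitary.coe_mul_star_self _
  have hU1 : star U * U = 1 := Unitary.star_mul_self_of_mem hU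
  have hU2 : U * star U = 1 := Unitary.mul_star_self_of_mem hU
  -- The squared moduli of the entries of the unitary `W` form a doubly stochastic matrix: the row
  -- sums allow Jensen's inequality, the column sums collapse the double sum.
  set W : Matrix ι ι ℂ := star U * V with hW
  have hW1 : star W * W = 1 := by
    rw [hW, star_mul, star_star, mul_assoc, ← mul_assoc U, hU2, one_mul, hV1]
  have hW2 : W * star W = 1 := by
    rw [hW, star_mul, star_star, mul_assoc, ← mul_assoc V, hV2, one_mul, hU1]
  have hrow : ∀ i, ∑ k, Complex.normSq (W i k) = 1 := by
    intro i
    have := congrFun (congrFun hW2 i) i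
    simp only [mul_apply, star_apply, one_apply_eq, RCLike.star_def, Complex.mul_conj] at this
    exact_mod_cast this
  have hcol : ∀ k, ∑ i, Complex.normSq (W i k) = 1 := by
    intro i
    have := congrFun (congrFun hW1 i) i
    simp only [mul_apply, star_apply, one_apply_eq, RCLike.star_def,
      mul_comm ((starRingEnd ℂ) _), Complex.mul_conj] at this
    exact_mod_cast this
  have hdiag : ∀ i, diagConj U B i = ∑ k, Complex.normSq (W i k) • hB.eigenvalues k := by
    intro i
    have h1 : star U * B * U = W * diagonal (fun i => (hB.eigenvalues i : ℂ)) * star W := by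
      conv_lhs => rw [hB.eq_conj_diagonal]
      simp only [hW, hV, star_mul, star_star, mul_assoc]
    rw [diagConj, h1, mul_apply, Complex.re_sum]
    refine Finset.sum_congr rfl fun k _ => ?_
    rw [mul_diagonal, star_apply, RCLike.star_def, mul_right_comm, Complex.mul_conj,
      ← Complex.ofReal_mul, Complex.ofReal_re, smul_eq_mul]
  calc ∑ i, f (diagConj U B i)
      ≤ ∑ i, ∑ k, Complex.normSq (W i k) • f (hB.eigenvalues k) := by
        refine Finset.sum_le_sum fun i _ => ?_
        rw [hdiag]
        exact hf.map_sum_le (fun k _ => Complex.normSq_nonneg _) (hrow i) fun _ _ => Set.mem_univ _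
    _ = ∑ k, f (hB.eigenvalues k) := by
        rw [Finset.sum_comm]
        refine Finset.sum_congr rfl fun k _ => ?_
        rw [← Finset.sum_smul, hcol, one_smul]

open scoped Matrix.Norms.Frobenius in
lemma sum_eigenvalues_sq {A : Matrix ι ι ℂ} (hA : A.IsHermitian) :
    ∑ i, hA.eigenvalues i ^ 2 = ‖A‖ ^ 2 := by
  have h2 := hA.trace_pow_eq 2
  have h3 : (A ^ 2).trace = ((∑ i, ∑ j, ‖A i j‖ ^ 2 : ℝ) : ℂ) := by
    rw [pow_two]
    nth_rewrite 2 [← hA.eq]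
    simp only [trace, diag_apply, mul_apply, conjTranspose_apply, RCLike.star_def]
    push_cast
    refine Finset.sum_congr rfl fun i _ => Finset.sum_congr rfl fun j _ => ?_
    rw [Complex.mul_conj, Complex.normSq_eq_norm_sq]
    push_cast; rfl
  rw [h3] at h2
  rw [frobenius_norm_sq]
  exact_mod_cast h2.symm

open scoped Matrix.Norms.Frobenius in
lemma sum_sq_diagConj_le {B : Matrix ι ι ℂ} (hB : B.IsHermitian) {U : Matrix ι ι ℂ}
    (hU : U ∈ unitaryGroup ι ℂ) : ∑ i, diagConj U B i ^ 2 ≤ ‖B‖ ^ 2 :=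
  (hB.sum_diagConj_le hU (even_two.convexOn_pow)).trans hB.sum_eigenvalues_sq.le

end IsHermitian

/-- The Schatten `2q`-norm of a Hermitian matrix. -/
noncomputable def evenSchatten (q : ℕ) (A : Matrix ι ι ℂ) : ℝ :=
  (A ^ (2 * q)).trace.re ^ (1 / (2 * q : ℝ))

lemma evenSchatten_eq (q : ℕ) {A : Matrix ι ι ℂ} (hA : A.IsHermitian) :
    evenSchatten q A = (∑ i, |hA.eigenvalues i| ^ (2 * q : ℝ)) ^ (1 / (2 * q : ℝ)) := by
  rw [evenSchatten, hA.trace_pow_eq]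
  congr 1
  rw [Complex.re_sum]
  refine Finset.sum_congr rfl fun i _ => ?_
  rw [← Complex.ofReal_pow, Complex.ofReal_re, show (2 * q : ℝ) = ((2 * q : ℕ) : ℝ) by push_cast; rfl,
    Real.rpow_natCast, (even_two_mul q).pow_abs]

lemma evenSchatten_nonneg (q : ℕ) {A : Matrix ι ι ℂ} (hA : A.IsHermitian) :
    0 ≤ evenSchatten q A := by
  rw [evenSchatten_eq q hA]; positivity

lemma convexOn_abs_rpow {p : ℝ} (hp : 1 ≤ p) : ConvexOn ℝ Set.univ fun x : ℝ => |x| ^ p := by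
  refine ⟨convex_univ, fun x _ y _ a b ha hb hab => ?_⟩
  calc |a • x + b • y| ^ p ≤ (a • |x| + b • |y|) ^ p := by
        refine Real.rpow_le_rpow (abs_nonneg _) ?_ (by linarith)
        refine (abs_add_le _ _).trans ?_
        simp [abs_mul, abs_of_nonneg ha, abs_of_nonneg hb]
    _ ≤ _ := (convexOn_rpow hp).2 (abs_nonneg x) (abs_nonneg y) ha hb hab

/-- In an eigenbasis of `A + B` the eigenvalues are sums of diagonal entries of `A` and `B`.
Minkowski's inequality in `ℓ^(2q)` separates them, and Peierls' inequality returns from diagonals to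
spectra. -/
lemma evenSchatten_add_le {q : ℕ} (hq : 1 ≤ q) {A B : Matrix ι ι ℂ} (hA : A.IsHermitian)
    (hB : B.IsHermitian) : evenSchatten q (A + B) ≤ evenSchatten q A + evenSchatten q B := by
  have hp : (1 : ℝ) ≤ 2 * q := by
    have : (1 : ℝ) ≤ q := by exact_mod_cast hq
    linarith
  rw [evenSchatten_eq q (hA.add hB), evenSchatten_eq q hA, evenSchatten_eq q hB]
  have hU := (hA.add hB).eigenvectorUnitary.2
  calc _ = (∑ i, |diagConj (hA.add hB).eigenvectorUnitary A i
        + diagConj (hA.add hB).eigenvectorUnitary B i| ^ (2 * q : ℝ)) ^ (1 / (2 * q : ℝ)) := by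
        congr 1
        refine Finset.sum_congr rfl fun i _ => ?_
        rw [← diagConj_add, (hA.add hB).diagConj_eigenvectorUnitary]
    _ ≤ _ := Real.Lp_add_le _ _ _ hp
    _ ≤ _ := by
        gcongr ?_ ^ _ + ?_ ^ _
        · exact hA.sum_diagConj_le hU (convexOn_abs_rpow hp)
        · exact hB.sum_diagConj_le hU (convexOn_abs_rpow hp)

lemma evenSchatten_smul {q : ℕ} (hq : 1 ≤ q) {A : Matrix ι ι ℂ} (hA : A.IsHermitian) {c : ℝ}
    (hc : 0 ≤ c) : evenSchatten q (c • A) = c * evenSchatten q A := by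
  have hq' : (q : ℝ) ≠ 0 := by positivity
  have h0 : 0 ≤ (A ^ (2 * q)).trace.re := by
    rw [hA.trace_pow_eq, Complex.re_sum]
    refine Finset.sum_nonneg fun i _ => ?_
    rw [← Complex.ofReal_pow, Complex.ofReal_re]
    exact (even_two_mul q).pow_nonneg _
  rw [evenSchatten, smul_pow, trace_smul, Complex.real_smul, Complex.re_ofReal_mul,
    Real.mul_rpow (by positivity) h0, evenSchatten, ← Real.rpow_natCast, ← Real.rpow_mul hc]
  congr 1
  rw [show ((2 * q : ℕ) : ℝ) * (1 / (2 * q)) = 1 by push_cast; field_simp, Real.rpow_one]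

lemma evenSchatten_zero {q : ℕ} (hq : 1 ≤ q) : evenSchatten q (0 : Matrix ι ι ℂ) = 0 := by
  have hq' : (q : ℝ) ≠ 0 := by positivity
  rw [evenSchatten, zero_pow (by positivity), trace_zero, Complex.zero_re,
    Real.zero_rpow (by positivity)]

lemma evenSchatten_sum_le {q : ℕ} (hq : 1 ≤ q) {κ : Type*} (s : Finset κ) (A : κ → Matrix ι ι ℂ)
    (hA : ∀ k ∈ s, (A k).IsHermitian) :
    evenSchatten q (∑ k ∈ s, A k) ≤ ∑ k ∈ s, evenSchatten q (A k) := by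
  classical
  have key : (∑ k ∈ s, A k).IsHermitian ∧
      evenSchatten q (∑ k ∈ s, A k) ≤ ∑ k ∈ s, evenSchatten q (A k) := by
    induction s using Finset.induction_on with
    | empty => simp [evenSchatten_zero hq]
    | insert a s ha ih =>
      obtain ⟨h1, h2⟩ := ih fun k hk => hA k (Finset.mem_insert_of_mem hk)
      have h3 := hA a (Finset.mem_insert_self a s)
      rw [Finset.sum_insert ha, Finset.sum_insert ha]
      exact ⟨h3.add h1, (evenSchatten_add_le hq h3 h1).trans (by gcongr)⟩
  exact key.2

lemma evenSchatten_pow {q : ℕ} (hq : 1 ≤ q) {A : Matrix ι ι ℂ} (hA : A.IsHermitian) :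
    evenSchatten q A ^ (2 * q) = ∑ i, hA.eigenvalues i ^ (2 * q) := by
  have hq' : (q : ℝ) ≠ 0 := by positivity
  have h0 : (A ^ (2 * q)).trace.re = ∑ i, hA.eigenvalues i ^ (2 * q) := by
    rw [hA.trace_pow_eq, Complex.re_sum]
    refine Finset.sum_congr rfl fun i _ => ?_
    rw [← Complex.ofReal_pow, Complex.ofReal_re]
  have h1 : 0 ≤ ∑ i, hA.eigenvalues i ^ (2 * q) :=
    Finset.sum_nonneg fun i _ => (even_two_mul q).pow_nonneg _
  rw [evenSchatten, h0, ← Real.rpow_natCast, ← Real.rpow_mul h1]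
  rw [show (1 / (2 * q)) * ((2 * q : ℕ) : ℝ) = 1 by push_cast; field_simp, Real.rpow_one]

open scoped Matrix.Norms.Frobenius in
lemma evenSchatten_le_norm {q : ℕ} (hq : 1 ≤ q) {A : Matrix ι ι ℂ} (hA : A.IsHermitian) :
    evenSchatten q A ≤ ‖A‖ := by
  refine le_of_pow_le_pow_left₀ (n := 2 * q) (by positivity) (norm_nonneg _) ?_
  rw [evenSchatten_pow hq hA, pow_mul, ← hA.sum_eigenvalues_sq]
  simp only [pow_mul]
  exact sum_pow_le_sum_pow _ (fun i => sq_nonneg _) hq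

open scoped Matrix.Norms.Frobenius in
lemma evenSchatten_sub_le {q : ℕ} (hq : 1 ≤ q) {A B : Matrix ι ι ℂ} (hA : A.IsHermitian)
    (hB : B.IsHermitian) : evenSchatten q A - evenSchatten q B ≤ ‖A - B‖ := by
  have h1 := evenSchatten_add_le hq (hA.sub hB) hB
  have h2 := evenSchatten_le_norm hq (hA.sub hB)
  rw [sub_add_cancel] at h1
  linarith

lemma evenSchatten_le_of_forall_abs_le {q : ℕ} (hq : 1 ≤ q) {A : Matrix ι ι ℂ}
    (hA : A.IsHermitian) {τ : ℝ} (hτ : 0 ≤ τ) (h : ∀ i, |hA.eigenvalues i| ≤ τ) :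
    evenSchatten q A ≤ (Fintype.card ι : ℝ) ^ (1 / (2 * q : ℝ)) * τ := by
  have hq' : (q : ℝ) ≠ 0 := by positivity
  refine le_of_pow_le_pow_left₀ (n := 2 * q) (by positivity) (by positivity) ?_
  rw [evenSchatten_pow hq hA, mul_pow, ← Real.rpow_natCast (_ ^ _), ← Real.rpow_mul (by positivity),
    show (1 / (2 * q)) * ((2 * q : ℕ) : ℝ) = 1 by push_cast; field_simp, Real.rpow_one]
  calc _ ≤ ∑ _i : ι, τ ^ (2 * q) := by
        refine Finset.sum_le_sum fun i _ => ?_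
        rw [← (even_two_mul q).pow_abs]
        have := h i
        gcongr
    _ = _ := by simp

/-! ### Tangents and slopes of the trace of the `d`-th power of the positive part. -/

/-- The trace of the `d`-th power of the positive part of a Hermitian matrix. -/
noncomputable def posPartTrace (d : ℕ) {A : Matrix ι ι ℂ} (hA : A.IsHermitian) : ℝ :=
  ∑ i, max (hA.eigenvalues i) 0 ^ d

/-- The right derivative at `x ≠ 0` of the `d`-th power of the positive part. -/
noncomputable def posPartSlope (d : ℕ) (x : ℝ) : ℝ := if 0 < x then d * x ^ (d - 1) else 0

lemma pow_add_mul_le_pow (d : ℕ) {a b : ℝ} (ha : 0 ≤ a) (hb : 0 ≤ b) :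
    a ^ d + d * a ^ (d - 1) * (b - a) ≤ b ^ d := by
  induction d with
  | zero => simp
  | succ d ih =>
    rcases d with _ | d
    · simp
    · simp only [Nat.add_sub_cancel] at ih ⊢
      have h1 := mul_le_mul_of_nonneg_right ih hb
      have h2 : 0 ≤ (d + 1 : ℝ) * a ^ d * (b - a) ^ 2 := by positivity
      -- The defect in raising the exponent by one is a nonnegative multiple of `(b - a) ^ 2`.
      have h3 : a ^ (d + 1 + 1) + ((d + 1 + 1 : ℕ) : ℝ) * a ^ (d + 1) * (b - a) =
          (a ^ (d + 1) + ((d + 1 : ℕ) : ℝ) * a ^ d * (b - a)) * b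
          - (d + 1 : ℝ) * a ^ d * (b - a) ^ 2 := by
        push_cast; ring
      rw [h3, pow_succ b]
      linarith

lemma posPart_pow_tangent (d : ℕ) (hd : 1 ≤ d) (x y : ℝ) :
    max x 0 ^ d + posPartSlope d x * (y - x) ≤ max y 0 ^ d := by
  unfold posPartSlope
  split_ifs with hx
  · rw [max_eq_left hx.le]
    refine le_trans ?_ (pow_add_mul_le_pow d hx.le (le_max_right y 0))
    gcongr
    exact le_max_left _ _
  · rw [max_eq_right (not_lt.1 hx), zero_pow (by omega), zero_mul, add_zero]
    positivity

lemma convexOn_posPart_pow (d : ℕ) : ConvexOn ℝ Set.univ fun x : ℝ => max x 0 ^ d := by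
  have h1 : ConvexOn ℝ Set.univ fun x : ℝ => max x 0 :=
    (convexOn_id convex_univ).sup (convexOn_const 0 convex_univ)
  exact h1.pow (fun x _ => le_max_right _ _) d

/-- No differentiation of eigenvalues is needed: apply the scalar tangent inequality to the diagonal
of `B` in an eigenbasis of `A`, then Peierls' inequality. The left side is affine in `B`. -/
lemma posPartTrace_tangent {d : ℕ} (hd : 1 ≤ d) {A B : Matrix ι ι ℂ} (hA : A.IsHermitian)
    (hB : B.IsHermitian) :
    posPartTrace d hA + ∑ i, posPartSlope d (hA.eigenvalues i)
      * diagConj hA.eigenvectorUnitary (B - A) i ≤ posPartTrace d hB := by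
  refine le_trans ?_ (hB.sum_diagConj_le hA.eigenvectorUnitary.2 (convexOn_posPart_pow d))
  rw [posPartTrace, ← Finset.sum_add_distrib]
  refine Finset.sum_le_sum fun i _ => ?_
  rw [diagConj_sub, hA.diagConj_eigenvectorUnitary]
  exact posPart_pow_tangent d hd _ _

open scoped Matrix.Norms.Frobenius in
-- Cauchy–Schwarz on the diagonal. This is where the Schatten norm of order `2(d-1)`, raised to the
-- power `d - 1`, enters as the local Lipschitz constant.
lemma sum_posPartSlope_mul_le (d : ℕ) {A D : Matrix ι ι ℂ} (hA : A.IsHermitian)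
    (hD : D.IsHermitian) :
    ∑ i, posPartSlope d (hA.eigenvalues i) * diagConj hA.eigenvectorUnitary D i
      ≤ d * √(∑ i, hA.eigenvalues i ^ (2 * (d - 1))) * ‖D‖ := by
  refine (Real.sum_mul_le_sqrt_mul_sqrt _ _ _).trans ?_
  gcongr
  · refine Real.sqrt_le_iff.2 ⟨by positivity, ?_⟩
    rw [mul_pow, Real.sq_sqrt (Finset.sum_nonneg fun i _ => (even_two_mul _).pow_nonneg _),
      Finset.mul_sum]
    refine Finset.sum_le_sum fun i _ => ?_
    unfold posPartSlope
    split_ifs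
    · rw [mul_pow, ← pow_mul, mul_comm (d - 1)]
    · rw [zero_pow (by norm_num)]
      exact mul_nonneg (by positivity) ((even_two_mul _).pow_nonneg _)
  · exact Real.sqrt_le_iff.2 ⟨norm_nonneg _, hD.sum_sq_diagConj_le hA.eigenvectorUnitary.2⟩

end Matrix

/-! ### Linearization of a product by a cyclic block matrix. -/

namespace Matrix

open scoped Kronecker

section CyclicBlock

variable {d : ℕ} {ι : Type*} [Fintype ι] [DecidableEq ι]

/-- The product `Y k * Y (k + 1) * ⋯ * Y (k + j - 1)` of cyclically indexed matrices. -/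
def cyclicProd (Y : ZMod d → Matrix ι ι ℂ) : ZMod d → ℕ → Matrix ι ι ℂ
  | _, 0 => 1
  | k, j + 1 => Y k * cyclicProd Y (k + 1) j

lemma cyclicProd_succ_right (Y : ZMod d → Matrix ι ι ℂ) (k : ZMod d) (j : ℕ) :
    cyclicProd Y k (j + 1) = cyclicProd Y k j * Y (k + j) := by
  induction j generalizing k with
  | zero => simp [cyclicProd]
  | succ j ih =>
    rw [cyclicProd, ih (k + 1), cyclicProd, mul_assoc]
    congr 3
    push_cast; ring

/-- Padding: positions past the end of the list read `none`, which contributes the identity, so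
words of every length up to `j` are covered. -/
lemma cyclicProd_eq_list_prod {α : Type*} (e : Option α → Matrix ι ι ℂ) (he : e none = 1)
    (Y : ZMod d → Matrix ι ι ℂ) (j : ℕ) (k : ZMod d) (l : List α)
    (hY : ∀ i < j, Y (k + i) = e l[i]?) (hl : l.length ≤ j) :
    cyclicProd Y k j = (l.map fun a => e (some a)).prod := by
  induction j generalizing k l with
  | zero =>
    rw [List.length_eq_zero_iff.1 (Nat.le_zero.1 hl)]
    simp [cyclicProd]
  | succ j ih =>
    have h0 := hY 0 (by omega)
    rw [Nat.cast_zero, add_zero] at h0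
    rw [cyclicProd, h0]
    cases l with
    | nil =>
      rw [ih (k + 1) [] (fun i hi => ?_) (by simp)]
      · simp [he]
      · have := hY (i + 1) (by omega)
        push_cast at this
        rw [add_assoc, add_comm 1, this]
        simp
    | cons a l =>
      rw [ih (k + 1) l (fun i hi => ?_) (by simpa using hl)]
      · simp
      · have := hY (i + 1) (by omega)
        push_cast at this
        rw [add_assoc, add_comm 1, this]
        simp

variable [NeZero d]

lemma trace_cyclicProd (Y : ZMod d → Matrix ι ι ℂ) (k : ZMod d) :
    (cyclicProd Y k d).trace = (cyclicProd Y 0 d).trace := by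
  have hstep : ∀ k, (cyclicProd Y (k + 1) d).trace = (cyclicProd Y k d).trace := by
    intro k
    obtain ⟨j, hj⟩ := Nat.exists_eq_succ_of_ne_zero (NeZero.ne d)
    have h0 : ((j + 1 : ℕ) : ZMod d) = 0 := by
      have := ZMod.natCast_self d
      rwa [hj] at this ⊢
    -- `d` also occurs in the type `ZMod d`, so the length is made a separate variable before it is
    -- replaced by `j + 1`.
    have h1 : ∀ e, e = j + 1 → (cyclicProd Y (k + 1) e).trace = (cyclicProd Y k e).trace := by
      rintro e rfl
      rw [cyclicProd_succ_right, cyclicProd, trace_mul_comm]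
      congr 3
      push_cast at h0
      rw [add_assoc, add_comm 1, h0, add_zero]
    exact h1 d hj
  have hnat : ∀ j : ℕ, (cyclicProd Y (j : ZMod d) d).trace = (cyclicProd Y 0 d).trace := by
    intro j
    induction j with
    | zero => simp
    | succ j ih => rw [Nat.cast_succ, hstep, ih]
  have := hnat k.val
  rwa [ZMod.natCast_zmod_val] at this

/-- The block matrix with the blocks `Y k` in the positions `(k, k + 1)`. -/
noncomputable def cyclicBlock (Y : ZMod d → Matrix ι ι ℂ) : Matrix (ZMod d × ι) (ZMod d × ι) ℂ :=
  ∑ k, single k (k + 1) (1 : ℂ) ⊗ₖ Y k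

lemma cyclicBlock_pow (Y : ZMod d → Matrix ι ι ℂ) (j : ℕ) :
    cyclicBlock Y ^ j = ∑ k, single k (k + (j : ZMod d)) (1 : ℂ) ⊗ₖ cyclicProd Y k j := by
  induction j with
  | zero =>
    have h : ∑ k : ZMod d, single k k (1 : ℂ) = 1 := by
      exact sum_single_one
    have h1 : ∑ k : ZMod d, single k k (1 : ℂ) ⊗ₖ (1 : Matrix ι ι ℂ)
        = (∑ k : ZMod d, single k k (1 : ℂ)) ⊗ₖ (1 : Matrix ι ι ℂ) := by
      ext ⟨a, a'⟩ ⟨b, b'⟩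
      simp only [sum_apply, kroneckerMap_apply, Finset.sum_mul]
    simp only [pow_zero, Nat.cast_zero, add_zero, cyclicProd]
    rw [h1, h, one_kronecker_one]
  | succ j ih =>
    rw [pow_succ', ih, cyclicBlock, Finset.sum_mul]
    refine Finset.sum_congr rfl fun k _ => ?_
    rw [Finset.mul_sum, Finset.sum_eq_single (k + 1)]
    · rw [← mul_kronecker_mul, single_mul_single_same, mul_one, cyclicProd]
      congr 2
      push_cast; ring
    · intro l _ hl
      rw [← mul_kronecker_mul, single_mul_single_of_ne _ _ _ _ hl.symm, zero_kronecker]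
    · simp

/-- After `d` steps around the cycle every block returns to the diagonal; the `d` diagonal blocks
are cyclic rotations of one product and have equal traces. -/
lemma trace_cyclicBlock_pow (Y : ZMod d → Matrix ι ι ℂ) :
    (cyclicBlock Y ^ d).trace = d * (cyclicProd Y 0 d).trace := by
  rw [cyclicBlock_pow, trace_sum]
  simp only [ZMod.natCast_self, add_zero, trace_kronecker, trace_single_eq_same, one_mul,
    trace_cyclicProd]
  rw [Finset.sum_const, Finset.card_univ, ZMod.card, nsmul_eq_mul]

end CyclicBlock

/-! ### Passage to Hermitian matrices by roots of unity, and the convex splitting of the trace. -/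

section RootsOfUnity

variable {ι : Type*}

/-- Twice the Hermitian part of `z • B`. -/
noncomputable def hermPart (z : ℂ) (B : Matrix ι ι ℂ) : Matrix ι ι ℂ := z • B + star z • Bᴴ

lemma isHermitian_hermPart (z : ℂ) (B : Matrix ι ι ℂ) : (hermPart z B).IsHermitian := by
  simp [hermPart, IsHermitian, conjTranspose_add, conjTranspose_smul, add_comm]

lemma hermPart_add (z : ℂ) (A B : Matrix ι ι ℂ) :
    hermPart z (A + B) = hermPart z A + hermPart z B := by
  simp only [hermPart, conjTranspose_add, smul_add]; abel

lemma hermPart_smul (z : ℂ) (c : ℝ) (A : Matrix ι ι ℂ) :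
    hermPart z (c • A) = c • hermPart z A := by
  simp only [hermPart, conjTranspose_smul, smul_add, smul_comm _ c, star_trivial]

lemma hermPart_neg_left (z : ℂ) (A : Matrix ι ι ℂ) : hermPart (-z) A = -hermPart z A := by
  simp only [hermPart, star_neg, neg_smul]; abel

variable [Fintype ι] [DecidableEq ι]

/-- A noncommutative binomial expansion in the scalar `w`. Only the constant coefficient has to be
known, since the averaging removes the others. -/
lemma exists_pow_add_smul_eq (B C : Matrix ι ι ℂ) (d : ℕ) :
    ∃ T : ℕ → Matrix ι ι ℂ, T 0 = B ^ d ∧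
      ∀ w : ℂ, (B + w • C) ^ d = ∑ j ∈ Finset.range (d + 1), w ^ j • T j := by
  induction d with
  | zero => exact ⟨fun _ => 1, by simp, fun w => by simp⟩
  | succ d ih =>
    obtain ⟨T, hT0, hT⟩ := ih
    refine ⟨fun j => (if j ≤ d then T j * B else 0) + (if 1 ≤ j then T (j - 1) * C else 0),
      by simp [hT0, pow_succ], fun w => ?_⟩
    rw [pow_succ, hT, mul_add]
    simp only [smul_add, Finset.sum_add_distrib]
    congr 1
    · rw [Finset.sum_range_succ _ (d + 1), Finset.sum_mul]
      simp only [add_le_iff_nonpos_right, nonpos_iff_eq_zero, one_ne_zero, if_false, smul_zero,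
        add_zero]
      refine Finset.sum_congr rfl fun j hj => ?_
      rw [if_pos (by simpa [Nat.lt_succ_iff] using hj), smul_mul_assoc]
    · rw [Finset.sum_range_succ' _ (d + 1), Finset.sum_mul]
      simp only [nonpos_iff_eq_zero, one_ne_zero, if_false, smul_zero, add_zero,
        Nat.le_add_left, if_true, Nat.add_sub_cancel]
      refine Finset.sum_congr rfl fun j _ => ?_
      rw [smul_mul_assoc, mul_smul_comm, smul_smul, pow_succ]

/-- For `z` of modulus one, `z⁻¹ • hermPart z B = B + z⁻² • Bᴴ`, so each summand is a polynomial of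
degree at most `d` in `z⁻²`. The sum over the roots kills `z^(-2j)` for `1 ≤ j ≤ d`, because then `0
< 2j < 2d + 1`. -/
lemma sum_trace_hermPart_pow (B : Matrix ι ι ℂ) {d M : ℕ} (hM : M = 2 * d + 1) {ζ : ℂ}
    (hζ : IsPrimitiveRoot ζ M) :
    ∑ i ∈ Finset.range M, ((ζ ^ i)⁻¹) ^ d * ((hermPart (ζ ^ i) B) ^ d).trace
      = M * (B ^ d).trace := by
  have hM0 : M ≠ 0 := by omega
  have hnorm : ‖ζ‖ = 1 := hζ.norm'_eq_one hM0
  have hζ0 : ζ ≠ 0 := hζ.ne_zero hM0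
  obtain ⟨T, hT0, hT⟩ := exists_pow_add_smul_eq B Bᴴ d
  have hterm : ∀ i, ((ζ ^ i)⁻¹) ^ d * ((hermPart (ζ ^ i) B) ^ d).trace
      = ∑ j ∈ Finset.range (d + 1), ((ζ ^ (2 * j))⁻¹) ^ i * (T j).trace := by
    intro i
    have hz0 : ζ ^ i ≠ 0 := pow_ne_zero _ hζ0
    have hstar : star (ζ ^ i) = (ζ ^ i)⁻¹ := by
      rw [RCLike.star_def, Complex.inv_def, Complex.normSq_eq_norm_sq, norm_pow, hnorm]
      simp
    have h1 : (ζ ^ i)⁻¹ • hermPart (ζ ^ i) B = B + ((ζ ^ i)⁻¹ ^ 2) • Bᴴ := by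
      rw [hermPart, hstar, smul_add, smul_smul, smul_smul, inv_mul_cancel₀ hz0, one_smul, pow_two]
    rw [← smul_eq_mul, ← trace_smul, ← smul_pow, h1, hT, trace_sum]
    refine Finset.sum_congr rfl fun j _ => ?_
    rw [trace_smul, smul_eq_mul]
    congr 1
    simp only [inv_pow, ← pow_mul]
    congr 2; ring
  simp only [hterm]
  rw [Finset.sum_comm, Finset.sum_range_succ', Finset.sum_eq_zero, zero_add]
  · simp [hT0]
  · intro j hj
    rw [← Finset.sum_mul]
    have hj' : j < d := Finset.mem_range.1 hj
    have hne : (ζ ^ (2 * (j + 1)))⁻¹ ≠ 1 := by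
      rw [Ne, inv_eq_one]
      exact hζ.pow_ne_one_of_pos_of_lt (by omega) (by omega)
    rw [geom_sum_eq hne]
    have : ((ζ ^ (2 * (j + 1)))⁻¹) ^ M = 1 := by
      rw [inv_pow, ← pow_mul, mul_comm, pow_mul, hζ.pow_eq_one, one_pow, inv_one]
    rw [this, sub_self, zero_div, zero_mul]

/-- The eigenvalues of `A` and `-A` are enumerated independently; Peierls' inequality in both
directions compares the sums without matching them. -/
lemma sum_eigenvalues_neg {A : Matrix ι ι ℂ} (hA : A.IsHermitian) {f : ℝ → ℝ}
    (hf : ConvexOn ℝ Set.univ f) :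
    ∑ i, f (hA.neg.eigenvalues i) = ∑ i, f (-hA.eigenvalues i) := by
  have hneg : ∀ U (B : Matrix ι ι ℂ) i, diagConj U (-B) i = -diagConj U B i := by
    intro U B i; simp [diagConj]
  refine le_antisymm ?_ ?_
  · have hf' : ConvexOn ℝ Set.univ fun x => f (-x) := by
      simpa [Function.comp_def] using hf.comp_linearMap (-LinearMap.id)
    have := hA.sum_diagConj_le hA.neg.eigenvectorUnitary.2 hf'
    simpa only [← hneg, hA.neg.diagConj_eigenvectorUnitary] using this
  · have := hA.neg.sum_diagConj_le hA.eigenvectorUnitary.2 hf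
    simpa only [hneg, hA.diagConj_eigenvectorUnitary] using this

/-- For odd `d` the power `x ^ d` is not convex, but its positive and negative parts are, up to
sign. At `d = 0` a zero part would contribute `1`. -/
lemma trace_pow_eq_posPartTrace {d : ℕ} (hd : 1 ≤ d) {A : Matrix ι ι ℂ} (hA : A.IsHermitian) :
    (A ^ d).trace = (posPartTrace d hA : ℂ) + (-1) ^ d * (posPartTrace d hA.neg : ℂ) := by
  have h1 : posPartTrace d hA.neg = ∑ i, max (-hA.eigenvalues i) 0 ^ d :=
    sum_eigenvalues_neg hA (convexOn_posPart_pow d)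
  rw [hA.trace_pow_eq, h1, posPartTrace]
  push_cast
  rw [Finset.mul_sum, ← Finset.sum_add_distrib]
  refine Finset.sum_congr rfl fun i _ => ?_
  rw [← mul_pow]
  norm_cast
  rcases le_total 0 (hA.eigenvalues i) with h | h
  · rw [max_eq_left h, max_eq_right (by linarith), mul_zero, zero_pow (by omega), add_zero]
  · rw [max_eq_right h, max_eq_left (by linarith), zero_pow (by omega), zero_add]
    push_cast; simp

end RootsOfUnity

end Matrix

/-! ### Operator, Schatten and Frobenius bounds for the block matrices. -/

namespace Matrix

open scoped Kronecker ComplexOrder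

section OpBound

variable {ι : Type*} [Fintype ι]

/-- The operator norm of `Y` on the Euclidean space is at most `τ`. -/
def OpBound (Y : Matrix ι ι ℂ) (τ : ℝ) : Prop :=
  ∀ u v : EuclideanSpace ℂ ι, ‖star u.ofLp ⬝ᵥ (Y *ᵥ v.ofLp)‖ ≤ τ * ‖u‖ * ‖v‖

lemma opBound_zero {τ : ℝ} (hτ : 0 ≤ τ) : OpBound (0 : Matrix ι ι ℂ) τ := by
  intro u v
  simp only [zero_mulVec, dotProduct_zero, norm_zero]
  positivity

lemma OpBound.conjTranspose {Y : Matrix ι ι ℂ} {τ : ℝ} (h : OpBound Y τ) : OpBound Yᴴ τ := by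
  intro u v
  have h1 : star u.ofLp ⬝ᵥ (Yᴴ *ᵥ v.ofLp) = star (star v.ofLp ⬝ᵥ (Y *ᵥ u.ofLp)) := by
    rw [star_dotProduct, star_mulVec, conjTranspose_conjTranspose, ← dotProduct_mulVec]
  rw [h1, norm_star]
  have := h v u
  linarith [mul_right_comm τ ‖v‖ ‖u‖]

lemma OpBound.smul {Y : Matrix ι ι ℂ} {τ : ℝ} (h : OpBound Y τ) {c : ℝ} (hc : 0 ≤ c) :
    OpBound (c • Y) (c * τ) := by
  intro u v
  rw [smul_mulVec, dotProduct_smul, norm_smul, Real.norm_of_nonneg hc, mul_assoc, mul_assoc]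
  exact mul_le_mul_of_nonneg_left ((h u v).trans_eq (mul_assoc _ _ _)) hc

lemma OpBound.hermPart {B : Matrix ι ι ℂ} {τ : ℝ} (h : OpBound B τ) {z : ℂ} (hz : ‖z‖ = 1) :
    OpBound (hermPart z B) (2 * τ) := by
  intro u v
  rw [Matrix.hermPart, add_mulVec, dotProduct_add, smul_mulVec, smul_mulVec, dotProduct_smul,
    dotProduct_smul]
  refine (norm_add_le _ _).trans ?_
  rw [norm_smul, norm_smul, norm_star, hz, one_mul, one_mul]
  linarith [h u v, h.conjTranspose u v]

end OpBound

section Blocks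

variable {d : ℕ} [NeZero d] {ι : Type*} [Fintype ι]

lemma star_dotProduct_single_kronecker_mulVec (k l : ZMod d) (Y : Matrix ι ι ℂ)
    (u v : ZMod d × ι → ℂ) :
    star u ⬝ᵥ ((single k l (1 : ℂ) ⊗ₖ Y) *ᵥ v)
      = star (fun i => u (k, i)) ⬝ᵥ (Y *ᵥ fun i => v (l, i)) := by
  simp only [dotProduct, mulVec, Fintype.sum_prod_type, kroneckerMap_apply, Pi.star_apply]
  rw [Finset.sum_eq_single k]
  · refine Finset.sum_congr rfl fun i _ => ?_
    rw [Finset.sum_eq_single l]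
    · simp
    · intro b _ hb
      simp [hb.symm]
    · simp
  · intro b _ hb
    simp [hb.symm]
  · simp

lemma norm_block_le (u : EuclideanSpace ℂ (ZMod d × ι)) (k : ZMod d) :
    ‖WithLp.toLp 2 (fun i => u (k, i))‖ ≤ ‖u‖ := by
  rw [EuclideanSpace.norm_eq, EuclideanSpace.norm_eq, Fintype.sum_prod_type]
  refine Real.sqrt_le_sqrt ?_
  exact Finset.single_le_sum (f := fun k => ∑ i, ‖u (k, i)‖ ^ 2)
    (fun k _ => by positivity) (Finset.mem_univ k)

lemma opBound_cyclicBlock {Y : ZMod d → Matrix ι ι ℂ} {τ : ℝ} (hτ : 0 ≤ τ)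
    (hY : ∀ k, OpBound (Y k) τ) : OpBound (cyclicBlock Y) (d * τ) := by
  intro u v
  rw [cyclicBlock, sum_mulVec, dotProduct_sum]
  refine (norm_sum_le _ _).trans ?_
  calc _ ≤ ∑ _k : ZMod d, τ * ‖u‖ * ‖v‖ := by
        refine Finset.sum_le_sum fun k _ => ?_
        rw [star_dotProduct_single_kronecker_mulVec]
        refine (hY k (WithLp.toLp 2 fun i => u (k, i)) (WithLp.toLp 2 fun i => v (k + 1, i))).trans ?_
        gcongr
        · exact norm_block_le u k
        · exact norm_block_le v (k + 1)
    _ = _ := by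
        rw [Finset.sum_const, Finset.card_univ, ZMod.card, nsmul_eq_mul]; ring

variable [DecidableEq ι]

lemma OpBound.abs_eigenvalues_le {A : Matrix ι ι ℂ} {τ : ℝ} (h : OpBound A τ)
    (hA : A.IsHermitian) (i : ι) : |hA.eigenvalues i| ≤ τ := by
  rw [hA.eigenvalues_eq]
  refine (RCLike.abs_re_le_norm _).trans ((h _ _).trans_eq ?_)
  simp [hA.eigenvectorBasis.orthonormal.1 i]

lemma evenSchatten_hermPart_cyclicBlock_le {q : ℕ} (hq : 1 ≤ q) {Y : ZMod d → Matrix ι ι ℂ}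
    {τ : ℝ} (hτ : 0 ≤ τ) (hY : ∀ k, OpBound (Y k) τ) {z : ℂ} (hz : ‖z‖ = 1) :
    evenSchatten q (hermPart z (cyclicBlock Y))
      ≤ (d * Fintype.card ι : ℝ) ^ (1 / (2 * q : ℝ)) * (2 * (d * τ)) := by
  have h := evenSchatten_le_of_forall_abs_le hq (isHermitian_hermPart z (cyclicBlock Y))
    (τ := 2 * (d * τ)) (by positivity)
    fun i => ((opBound_cyclicBlock hτ hY).hermPart hz).abs_eigenvalues_le _ i
  rwa [Fintype.card_prod, ZMod.card, Nat.cast_mul] at h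

lemma hermPart_sq_of_mul_self_eq_zero {E : Matrix ι ι ℂ} (hE : E * E = 0) {z : ℂ} (hz : ‖z‖ = 1) :
    hermPart z E ^ 2 = E * Eᴴ + Eᴴ * E := by
  have hE' : Eᴴ * Eᴴ = 0 := by rw [← conjTranspose_mul, hE, conjTranspose_zero]
  have hzz : z * star z = 1 := by
    rw [RCLike.star_def, Complex.mul_conj, Complex.normSq_eq_norm_sq, hz]; simp
  rw [pow_two, hermPart, add_mul, mul_add, mul_add]
  simp only [smul_mul_smul_comm, hE, hE', smul_zero, zero_add, add_zero, hzz, one_smul,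
    mul_comm (star z) z]

lemma add_pow_of_mul_eq_zero {R : Type*} [Ring R] {a b : R} (hab : a * b = 0) (hba : b * a = 0)
    {q : ℕ} (hq : 1 ≤ q) : (a + b) ^ q = a ^ q + b ^ q := by
  induction q, hq using Nat.le_induction with
  | base => simp
  | succ q hq ih =>
    obtain ⟨r, rfl⟩ := Nat.exists_eq_add_of_le' hq
    rw [pow_succ, ih, add_mul, mul_add, mul_add, pow_succ a r, pow_succ b r, mul_assoc _ a b, hab,
      mul_assoc _ b a, hba]
    simp only [pow_succ, mul_zero, add_zero, zero_add]

lemma trace_mul_pow_comm (E F : Matrix ι ι ℂ) (q : ℕ) :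
    ((E * F) ^ q).trace = ((F * E) ^ q).trace := by
  rcases q with _ | q
  · simp
  · have h : ∀ q, (E * F) ^ q * E = E * (F * E) ^ q := fun q => by
      induction q with
      | zero => simp
      | succ q ih => rw [pow_succ', mul_assoc, ih, pow_succ', mul_assoc, mul_assoc]
    rw [pow_succ, ← mul_assoc, h, trace_mul_comm, ← mul_assoc, pow_succ']

/-- A single block `E` is off the diagonal when `d ≥ 2`, so `E * E = 0`. The square of the Hermitian
part is then `E * Eᴴ + Eᴴ * E`, whose summands annihilate each other and have powers of equal trace.
-/
lemma trace_hermPart_single_kronecker_pow (hd : 2 ≤ d) {q : ℕ} (hq : 1 ≤ q) (k : ZMod d)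
    (Y : Matrix ι ι ℂ) {z : ℂ} (hz : ‖z‖ = 1) :
    (hermPart z (single k (k + 1) (1 : ℂ) ⊗ₖ Y) ^ (2 * q)).trace = 2 * ((Yᴴ * Y) ^ q).trace := by
  have : Fact (1 < d) := ⟨hd⟩
  have hk : k + 1 ≠ k := by simp
  set E : Matrix (ZMod d × ι) (ZMod d × ι) ℂ := single k (k + 1) (1 : ℂ) ⊗ₖ Y with hE
  have hEE : E * E = 0 := by
    rw [hE, ← mul_kronecker_mul, single_mul_single_of_ne _ _ _ _ hk, zero_kronecker]
  have hEE' : Eᴴ * Eᴴ = 0 := by rw [← conjTranspose_mul, hEE, conjTranspose_zero]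
  have h1 : E * Eᴴ * (Eᴴ * E) = 0 := by
    rw [mul_assoc, ← mul_assoc Eᴴ, hEE', zero_mul, mul_zero]
  have h2 : Eᴴ * E * (E * Eᴴ) = 0 := by
    rw [mul_assoc, ← mul_assoc E, hEE, zero_mul, mul_zero]
  have h3 : ∀ q : ℕ, 1 ≤ q →
      (Eᴴ * E) ^ q = single (k + 1) (k + 1) (1 : ℂ) ⊗ₖ ((Yᴴ * Y) ^ q) := by
    intro q hq
    induction q, hq using Nat.le_induction with
    | base =>
      rw [pow_one, pow_one, hE, conjTranspose_kronecker, conjTranspose_single, star_one,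
        ← mul_kronecker_mul, single_mul_single_same, mul_one]
    | succ q hq ih =>
      have h4 := ih
      rw [pow_succ, ih, hE, conjTranspose_kronecker, conjTranspose_single, star_one,
        ← mul_kronecker_mul, single_mul_single_same, ← mul_kronecker_mul, single_mul_single_same,
        mul_one, mul_one, pow_succ]
  rw [pow_mul, hermPart_sq_of_mul_self_eq_zero hEE hz, add_pow_of_mul_eq_zero h1 h2 hq, trace_add,
    trace_mul_pow_comm, h3 q hq, trace_kronecker, trace_single_eq_same, one_mul, two_mul]

lemma trace_conjTranspose_mul_self_pow_nonneg (Y : Matrix ι ι ℂ) (q : ℕ) :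
    0 ≤ ((Yᴴ * Y) ^ q).trace.re := by
  have h := isHermitian_conjTranspose_mul_self Y
  rw [h.trace_pow_eq, Complex.re_sum]
  refine Finset.sum_nonneg fun i _ => ?_
  rw [← Complex.ofReal_pow, Complex.ofReal_re]
  exact pow_nonneg ((posSemidef_conjTranspose_mul_self Y).eigenvalues_nonneg i) _

lemma evenSchatten_hermPart_cyclicBlock_le_of_trace (hd : 2 ≤ d) {q : ℕ} (hq : 1 ≤ q)
    {Y : ZMod d → Matrix ι ι ℂ} {R N : ℝ} (hR : 0 ≤ R) (hN : 0 ≤ N)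
    (hY : ∀ k, ((((Y k)ᴴ * Y k) ^ q).trace).re ≤ R ^ (2 * q) * N) {z : ℂ} (hz : ‖z‖ = 1) :
    evenSchatten q (hermPart z (cyclicBlock Y)) ≤ d * (2 * R * N ^ (1 / (2 * q : ℝ))) := by
  have hq' : (q : ℝ) ≠ 0 := by positivity
  have h1 : hermPart z (cyclicBlock Y)
      = ∑ k : ZMod d, hermPart z (single k (k + 1) (1 : ℂ) ⊗ₖ Y k) := by
    simp only [hermPart, cyclicBlock, conjTranspose_sum, Finset.smul_sum, Finset.sum_add_distrib]
  rw [h1]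
  refine (evenSchatten_sum_le hq _ _ fun k _ => isHermitian_hermPart _ _).trans ?_
  calc _ ≤ ∑ _k : ZMod d, 2 * R * N ^ (1 / (2 * q : ℝ)) := by
        refine Finset.sum_le_sum fun k _ => ?_
        have h0 := trace_conjTranspose_mul_self_pow_nonneg (Y k) q
        rw [evenSchatten, trace_hermPart_single_kronecker_pow hd hq k (Y k) hz]
        -- The factor `2` from the two off-diagonal blocks is absorbed by `2 ^ (2 * q)`.
        have h2 : (2 * (((Y k)ᴴ * Y k) ^ q).trace).re ≤ (2 * R) ^ (2 * q) * N := by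
          have h3 : (2 * (((Y k)ᴴ * Y k) ^ q).trace).re = 2 * (((Y k)ᴴ * Y k) ^ q).trace.re := by
            simp
          rw [h3, mul_pow, mul_assoc]
          refine mul_le_mul (le_self_pow₀ (by norm_num) (by omega)) (hY k) h0 (by positivity)
        calc _ ≤ ((2 * R) ^ (2 * q) * N) ^ (1 / (2 * q : ℝ)) := by
              refine Real.rpow_le_rpow ?_ h2 (by positivity)
              simpa using h0
          _ = _ := by
              rw [Real.mul_rpow (by positivity) hN, ← Real.rpow_natCast,
                ← Real.rpow_mul (by positivity),
                show ((2 * q : ℕ) : ℝ) * (1 / (2 * q)) = 1 by push_cast; field_simp, Real.rpow_one]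
    _ = _ := by
        rw [Finset.sum_const, Finset.card_univ, ZMod.card, nsmul_eq_mul]

open scoped Matrix.Norms.Frobenius in
lemma norm_single_kronecker (k l : ZMod d) (Y : Matrix ι ι ℂ) :
    ‖single k l (1 : ℂ) ⊗ₖ Y‖ = ‖Y‖ := by
  refine (sq_eq_sq₀ (norm_nonneg _) (norm_nonneg _)).1 ?_
  rw [frobenius_norm_sq, frobenius_norm_sq]
  simp only [Fintype.sum_prod_type, kroneckerMap_apply]
  rw [Finset.sum_eq_single k]
  · refine Finset.sum_congr rfl fun i _ => ?_
    rw [Finset.sum_eq_single l]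
    · simp
    · intro b _ hb
      simp [hb.symm]
    · simp
  · intro b _ hb
    simp [hb.symm]
  · simp

open scoped Matrix.Norms.Frobenius in
lemma norm_hermPart_cyclicBlock_le {Y : ZMod d → Matrix ι ι ℂ} {τ : ℝ}
    (hY : ∀ k, ‖Y k‖ ≤ τ) {z : ℂ} (hz : ‖z‖ = 1) :
    ‖hermPart z (cyclicBlock Y)‖ ≤ 2 * (d * τ) := by
  have h1 : ‖cyclicBlock Y‖ ≤ d * τ := by
    refine (norm_sum_le _ _).trans ?_
    simp only [norm_single_kronecker]
    refine (Finset.sum_le_sum fun k _ => hY k).trans_eq ?_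
    rw [Finset.sum_const, Finset.card_univ, ZMod.card, nsmul_eq_mul]
  rw [hermPart]
  refine (norm_add_le _ _).trans ?_
  rw [norm_smul, norm_smul, norm_star, hz, frobenius_norm_conjTranspose]
  linarith

end Blocks

lemma trace_pow_le_of_schattenNorm_le {n q : ℕ} (hq : 1 ≤ q) {A : Matrix (Fin n) (Fin n) ℂ}
    {R : ℝ} (h : schattenNorm (2 * (q : ℝ)) A ≤ R) :
    ((Aᴴ * A) ^ q).trace.re ≤ R ^ (2 * q) := by
  have hq' : (q : ℝ) ≠ 0 := by positivity
  have hH := isHermitian_conjTranspose_mul_self A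
  have hnn : ∀ i, 0 ≤ hH.eigenvalues i := (posSemidef_conjTranspose_mul_self A).eigenvalues_nonneg
  have h1 : ((Aᴴ * A) ^ q).trace.re = ∑ i, hH.eigenvalues i ^ q := by
    rw [hH.trace_pow_eq, Complex.re_sum]
    refine Finset.sum_congr rfl fun i _ => ?_
    rw [← Complex.ofReal_pow, Complex.ofReal_re]
  have h0 : 0 ≤ ∑ i, hH.eigenvalues i ^ q := Finset.sum_nonneg fun i _ => pow_nonneg (hnn i) _
  have h2 : schattenNorm (2 * (q : ℝ)) A = (∑ i, hH.eigenvalues i ^ q) ^ (1 / (2 * q : ℝ)) := by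
    rw [schattenNorm]
    simp only [mul_div_cancel_left₀ (q : ℝ) (two_ne_zero' ℝ), Real.rpow_natCast]
  rw [h2] at h
  rw [h1]
  calc _ = ((∑ i, hH.eigenvalues i ^ q) ^ (1 / (2 * q : ℝ))) ^ (2 * q) := by
        rw [← Real.rpow_natCast, ← Real.rpow_mul h0,
          show (1 / (2 * q)) * ((2 * q : ℕ) : ℝ) = 1 by push_cast; field_simp, Real.rpow_one]
    _ ≤ _ := by gcongr

end Matrix

/-! ### Nets of the unit ball and the operator norm. -/

section Net

/-- A `1/2`-net of the unit ball of exponential cardinality. -/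
lemma exists_half_net (E : Type*) [NormedAddCommGroup E] [NormedSpace ℝ E] [FiniteDimensional ℝ E] :
    ∃ T : Finset E, T.card ≤ 5 ^ Module.finrank ℝ E ∧ (∀ c ∈ T, ‖c‖ ≤ 1) ∧
      ∀ x : E, ‖x‖ ≤ 1 → ∃ c ∈ T, ‖x - c‖ ≤ 1 / 2 := by
  classical
  -- Cardinalities of `1`-separated sets in the ball of radius `2`, bounded by `5 ^ dim`. A largest
  -- such set, halved, is the net.
  let S : Set ℕ := {k | ∃ s : Finset E, (∀ c ∈ s, ‖c‖ ≤ 2) ∧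
    (∀ c ∈ s, ∀ d ∈ s, c ≠ d → 1 ≤ ‖c - d‖) ∧ s.card = k}
  have hne : S.Nonempty := ⟨0, ∅, by simp, by simp, rfl⟩
  have hbdd : BddAbove S := by
    refine ⟨5 ^ Module.finrank ℝ E, ?_⟩
    rintro k ⟨s, h1, h2, rfl⟩
    exact Besicovitch.card_le_of_separated s h1 h2
  obtain ⟨s, h1, h2, h3⟩ := Nat.sSup_mem hne hbdd
  refine ⟨s.image fun c => (1 / 2 : ℝ) • c,
    Finset.card_image_le.trans (Besicovitch.card_le_of_separated s h1 h2), ?_, fun x hx => ?_⟩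
  · intro c hc
    obtain ⟨c', hc', rfl⟩ := Finset.mem_image.1 hc
    rw [norm_smul, Real.norm_of_nonneg (by norm_num)]
    linarith [h1 c' hc']
  · by_contra! hcon
    have hfar : ∀ c ∈ s, 1 < ‖(2 : ℝ) • x - c‖ := by
      intro c hc
      have h4 := hcon _ (Finset.mem_image_of_mem _ hc)
      have h5 : (2 : ℝ) • x - c = (2 : ℝ) • (x - (1 / 2 : ℝ) • c) := by
        rw [smul_sub, smul_smul]; norm_num
      rw [h5, norm_smul, Real.norm_of_nonneg (by norm_num)]
      linarith
    have hx2 : ‖(2 : ℝ) • x‖ ≤ 2 := by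
      rw [norm_smul, Real.norm_of_nonneg (by norm_num)]; linarith
    have hnot : (2 : ℝ) • x ∉ s := fun hmem => by
      have := hfar _ hmem
      rw [sub_self, norm_zero] at this
      linarith
    have hmem : s.card + 1 ∈ S := by
      refine ⟨insert ((2 : ℝ) • x) s, ?_, ?_, Finset.card_insert_of_notMem hnot⟩
      · intro c hc
        rcases Finset.mem_insert.1 hc with rfl | hc
        exacts [hx2, h1 c hc]
      · intro c hc d hd hcd
        rcases Finset.mem_insert.1 hc with rfl | hc <;> rcases Finset.mem_insert.1 hd with rfl | hd
        · exact absurd rfl hcd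
        · exact (hfar d hd).le
        · rw [norm_sub_rev]; exact (hfar c hc).le
        · exact h2 c hc d hd hcd
    have := le_csSup hbdd hmem
    omega

/-- Each of the two arguments is approximated once, losing a factor `2` each time. Real parts
suffice because the unit vector approximated on the left is aligned with `L v`. -/
lemma ContinuousLinearMap.opNorm_le_of_half_net {E : Type*} [NormedAddCommGroup E]
    [InnerProductSpace ℂ E] (L : E →L[ℂ] E) {T : Finset E}
    (hnet : ∀ x : E, ‖x‖ ≤ 1 → ∃ c ∈ T, ‖x - c‖ ≤ 1 / 2) {τ : ℝ} (hτ : 0 ≤ τ)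
    (h : ∀ u ∈ T, ∀ v ∈ T, RCLike.re (inner ℂ u (L v)) ≤ τ) : ‖L‖ ≤ 4 * τ := by
  have h1 : ∀ v ∈ T, ‖L v‖ ≤ 2 * τ := by
    intro v hv
    rcases eq_or_ne (L v) 0 with h0 | h0
    · rw [h0, norm_zero]; linarith
    · have hpos : 0 < ‖L v‖ := norm_pos_iff.2 h0
      set w : E := ((‖L v‖⁻¹ : ℝ) : ℂ) • L v with hw
      have hwn : ‖w‖ = 1 := by
        rw [hw, norm_smul, Complex.norm_real, norm_inv, norm_norm, inv_mul_cancel₀ hpos.ne']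
      obtain ⟨u, hu, hwu⟩ := hnet w hwn.le
      have h2 : RCLike.re (inner ℂ w (L v)) = ‖L v‖ := by
        rw [hw, inner_smul_left, inner_self_eq_norm_sq_to_K, Complex.conj_ofReal]
        simp only [Complex.coe_algebraMap, RCLike.re_to_complex]
        rw [← Complex.ofReal_pow, ← Complex.ofReal_mul, Complex.ofReal_re, pow_two,
          inv_mul_cancel_left₀ hpos.ne']
      have h3 : RCLike.re (inner ℂ w (L v))
          = RCLike.re (inner ℂ u (L v)) + RCLike.re (inner ℂ (w - u) (L v)) := by
        rw [← map_add, ← inner_add_left]; congr 2; abel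
      have h4 : RCLike.re (inner ℂ (w - u) (L v)) ≤ 1 / 2 * ‖L v‖ :=
        (re_inner_le_norm _ _).trans (by gcongr)
      linarith [h u hu v hv]
  have h2 : ‖L‖ ≤ 2 * τ + ‖L‖ / 2 := by
    refine ContinuousLinearMap.opNorm_le_of_unit_norm (by positivity) fun x hx => ?_
    obtain ⟨c, hc, hxc⟩ := hnet x hx.le
    have h3 : L x = L c + L (x - c) := by rw [map_sub]; abel
    rw [h3]
    refine (norm_add_le _ _).trans (add_le_add (h1 c hc) ((L.le_opNorm _).trans ?_))
    have := norm_nonneg L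
    nlinarith
  linarith

end Net

namespace Matrix

variable {n : ℕ}

lemma inner_toEuclideanCLM_complex (A : Matrix (Fin n) (Fin n) ℂ)
    (u v : EuclideanSpace ℂ (Fin n)) :
    inner ℂ u (toEuclideanCLM (𝕜 := ℂ) A v) = star u.ofLp ⬝ᵥ (A *ᵥ v.ofLp) := by
  rw [EuclideanSpace.inner_eq_star_dotProduct, ofLp_toEuclideanCLM, dotProduct_comm]

lemma opBound_of_half_net (A : Matrix (Fin n) (Fin n) ℂ) {T : Finset (EuclideanSpace ℂ (Fin n))}
    (hnet : ∀ x : EuclideanSpace ℂ (Fin n), ‖x‖ ≤ 1 → ∃ c ∈ T, ‖x - c‖ ≤ 1 / 2) {τ : ℝ}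
    (hτ : 0 ≤ τ) (h : ∀ u ∈ T, ∀ v ∈ T, (star u.ofLp ⬝ᵥ (A *ᵥ v.ofLp)).re ≤ τ) :
    OpBound A (4 * τ) := by
  have h1 := (toEuclideanCLM (𝕜 := ℂ) A).opNorm_le_of_half_net hnet hτ
    fun u hu v hv => by
      rw [inner_toEuclideanCLM_complex]; exact h u hu v hv
  intro u v
  rw [← inner_toEuclideanCLM_complex]
  calc _ ≤ ‖u‖ * ‖toEuclideanCLM (𝕜 := ℂ) A v‖ := norm_inner_le_norm _ _
    _ ≤ ‖u‖ * (4 * τ * ‖v‖) := by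
        gcongr
        exact (ContinuousLinearMap.le_opNorm _ _).trans (by gcongr)
    _ = _ := by ring

open scoped Matrix.Norms.Frobenius in
lemma opBound_frobenius (A : Matrix (Fin n) (Fin n) ℂ) : OpBound A ‖A‖ := by
  intro u v
  have h1 : star u.ofLp ⬝ᵥ (A *ᵥ v.ofLp)
      = (replicateRow Unit (star u.ofLp) * (A * replicateCol Unit v.ofLp)) () () := by
    rw [mul_apply]
    simp [dotProduct, mulVec, mul_apply]
  rw [h1]
  refine (norm_entry_le_frobenius _ _ _).trans ((frobenius_norm_mul _ _).trans ?_)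
  calc _ ≤ ‖replicateRow Unit (star u.ofLp)‖ * (‖A‖ * ‖replicateCol Unit v.ofLp‖) := by
        gcongr; exact frobenius_norm_mul _ _
    _ = ‖A‖ * ‖u‖ * ‖v‖ := by
        rw [frobenius_norm_replicateRow, frobenius_norm_replicateCol]
        have : ‖WithLp.toLp 2 (star u.ofLp)‖ = ‖u‖ := by
          simp [EuclideanSpace.norm_eq]
        rw [this]
        ring

end Matrix

/-! ### Operator norm of the fluctuations of one random matrix. -/

section OperatorNorm

open scoped Matrix.Norms.Frobenius

instance frobeniusBorelSpace (n : ℕ) : @BorelSpace (Matrix (Fin n) (Fin n) ℂ)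
    (PseudoMetricSpace.toUniformSpace.toTopologicalSpace) _ :=
  instBorelSpaceComplexMatrix n

instance frobeniusSecondCountable (n : ℕ) : @SecondCountableTopology (Matrix (Fin n) (Fin n) ℂ)
    (PseudoMetricSpace.toUniformSpace.toTopologicalSpace) :=
  inferInstanceAs (SecondCountableTopology (Fin n → Fin n → ℂ))

/-- The scale, relative to `√n`, of the fluctuations of the operator norm. -/
noncomputable def opScale (K κ δ : ℝ) : ℝ := √((7 + |Real.log (K / δ)|) / κ)

variable {n : ℕ} {ν : Measure (Matrix (Fin n) (Fin n) ℂ)} [IsProbabilityMeasure ν] {K κ : ℝ}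

/-- The bilinear form is real-linear in `x` and bounded by the Frobenius norm, hence convex and
`1`-Lipschitz; its mean is its value at the mean matrix. -/
lemma MeanConcentration.tail_bilinear (h : MeanConcentration ν K κ) (hK : 0 ≤ K) (hκ : 0 < κ)
    {u v : EuclideanSpace ℂ (Fin n)} (hu : ‖u‖ ≤ 1) (hv : ‖v‖ ≤ 1) {t : ℝ} (ht : 0 < t) :
    ν.real {x | t ≤ (star u.ofLp ⬝ᵥ ((x - Matrix.of fun i j => ∫ y, y i j ∂ν) *ᵥ v.ofLp)).re}
      ≤ K * Real.exp (-κ * t ^ 2) := by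
  set φ : Matrix (Fin n) (Fin n) ℂ → ℝ := fun x => (star u.ofLp ⬝ᵥ (x *ᵥ v.ofLp)).re with hφ
  have hsub : ∀ x y, φ x - φ y = φ (x - y) := by
    intro x y; simp [hφ, Matrix.sub_mulVec]
  have hle : ∀ x, φ x ≤ ‖x‖ := by
    intro x
    refine (Complex.re_le_norm _).trans ((Matrix.opBound_frobenius x u v).trans ?_)
    have := norm_nonneg x
    calc ‖x‖ * ‖u‖ * ‖v‖ ≤ ‖x‖ * 1 * 1 := by gcongr
      _ = ‖x‖ := by ring
  have hc : ConvexOn ℝ Set.univ φ := by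
    refine ⟨convex_univ, fun x _ y _ a b _ _ _ => le_of_eq ?_⟩
    simp [hφ, Matrix.add_mulVec, Matrix.smul_mulVec]
  have hl : LipschitzWith 1 φ := by
    refine LipschitzWith.of_le_add_mul 1 fun x y => ?_
    have := hle (x - y)
    rw [← hsub] at this
    rw [NNReal.coe_one, one_mul, dist_eq_norm]
    linarith
  have hentry : ∀ i j, Integrable (fun x : Matrix (Fin n) (Fin n) ℂ => x i j) ν := by
    intro i j
    have hm : Measurable fun x : Matrix (Fin n) (Fin n) ℂ => x i j :=
      (measurable_pi_apply j).comp (measurable_pi_apply (X := fun _ : Fin n => Fin n → ℂ) i)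
    exact (h.integrable_norm hK hκ).mono' hm.aestronglyMeasurable
      (Filter.Eventually.of_forall fun x => Matrix.norm_entry_le_frobenius x i j)
  have hmean : ∫ x, φ x ∂ν = φ (Matrix.of fun i j => ∫ y, y i j ∂ν) := by
    have h1 : ∀ i j, Integrable (fun x : Matrix (Fin n) (Fin n) ℂ =>
        star (u.ofLp i) * (x i j * v.ofLp j)) ν :=
      fun i j => ((hentry i j).mul_const _).const_mul _
    have h2 : ∀ x, φ x = RCLike.re (∑ i, ∑ j, star (u.ofLp i) * (x i j * v.ofLp j)) := by
      intro x
      simp [hφ, dotProduct, Matrix.mulVec, Finset.mul_sum]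
    simp only [h2]
    rw [integral_re (integrable_finsetSum _ fun i _ => integrable_finsetSum _ fun j _ => h1 i j),
      integral_finsetSum _ fun i _ => integrable_finsetSum _ fun j _ => h1 i j]
    congr 1
    refine Finset.sum_congr rfl fun i _ => ?_
    rw [integral_finsetSum _ fun j _ => h1 i j]
    refine Finset.sum_congr rfl fun j _ => ?_
    rw [integral_const_mul, integral_mul_const, Matrix.of_apply]
  have h3 := h φ hc hl t ht
  rw [rate_one_one] at h3
  refine (measureReal_mono fun x hx => ?_).trans h3
  simp only [Set.mem_ofPred_eq] at hx ⊢
  rw [hmean, hsub]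
  exact hx.trans (Real.le_norm_self _)

/-- With large probability the operator norm of the fluctuations is of order `√n`. -/
lemma MeanConcentration.measure_not_opBound_le (h : MeanConcentration ν K κ) (hK : 0 < K)
    (hκ : 0 < κ) (hn : 1 ≤ n) {δ : ℝ} (hδ : 0 < δ) :
    ν.real {x | ¬ Matrix.OpBound (x - Matrix.of fun i j => ∫ y, y i j ∂ν)
      (4 * (opScale K κ δ * √n))} ≤ δ := by
  have hn' : (1 : ℝ) ≤ n := by exact_mod_cast hn
  set t : ℝ := opScale K κ δ * √n with ht
  have hsc : 0 < opScale K κ δ := by unfold opScale; positivity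
  have ht0 : 0 < t := by positivity
  obtain ⟨T, hcard, hT, hnet⟩ := exists_half_net (EuclideanSpace ℂ (Fin n))
  rw [finrank_real_of_complex, finrank_euclideanSpace_fin] at hcard
  have hsub : {x : Matrix (Fin n) (Fin n) ℂ |
      ¬ Matrix.OpBound (x - Matrix.of fun i j => ∫ y, y i j ∂ν) (4 * t)}
      ⊆ ⋃ p ∈ T ×ˢ T, {x | t ≤ (star p.1.ofLp ⬝ᵥ
        ((x - Matrix.of fun i j => ∫ y, y i j ∂ν) *ᵥ p.2.ofLp)).re} := by
    intro x hx
    by_contra hcon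
    refine hx (Matrix.opBound_of_half_net _ hnet ht0.le fun u hu v hv => ?_)
    simp only [Set.mem_iUnion, not_exists] at hcon
    exact (not_le.1 (hcon (u, v) (Finset.mem_product.2 ⟨hu, hv⟩))).le
  -- The real dimension is `2n`, so there are at most `5^(4n) = 625^n` pairs, and `625 < e^7`: the
  -- source of the `7` in `opScale`.
  have hcard' : ((T ×ˢ T).card : ℝ) ≤ Real.exp (7 * n) := by
    rw [Finset.card_product]
    have h1 : ((T.card * T.card : ℕ) : ℝ) ≤ (625 : ℝ) ^ n := by
      have : T.card * T.card ≤ 625 ^ n := by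
        calc T.card * T.card ≤ 5 ^ (2 * n) * 5 ^ (2 * n) := Nat.mul_le_mul hcard hcard
          _ = 625 ^ n := by rw [← pow_add, ← two_mul, ← mul_assoc, pow_mul]; norm_num
      exact_mod_cast this
    refine h1.trans ?_
    rw [mul_comm, Real.exp_nat_mul]
    gcongr
    have h2 : (2.7 : ℝ) ≤ Real.exp 1 := by linarith [Real.exp_one_gt_d9]
    calc (625 : ℝ) ≤ 2.7 ^ 7 := by norm_num
      _ ≤ Real.exp 1 ^ 7 := by gcongr
      _ = Real.exp 7 := by rw [← Real.exp_nat_mul]; norm_num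
  calc _ ≤ ν.real (⋃ p ∈ T ×ˢ T, {x | t ≤ (star p.1.ofLp ⬝ᵥ
        ((x - Matrix.of fun i j => ∫ y, y i j ∂ν) *ᵥ p.2.ofLp)).re}) :=
        measureReal_mono hsub (measure_ne_top _ _)
    _ ≤ ∑ p ∈ T ×ˢ T, ν.real {x | t ≤ (star p.1.ofLp ⬝ᵥ
        ((x - Matrix.of fun i j => ∫ y, y i j ∂ν) *ᵥ p.2.ofLp)).re} :=
        measureReal_biUnion_finset_le _ _
    _ ≤ ∑ _p ∈ T ×ˢ T, K * Real.exp (-κ * t ^ 2) := by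
        refine Finset.sum_le_sum fun p hp => ?_
        obtain ⟨h1, h2⟩ := Finset.mem_product.1 hp
        exact h.tail_bilinear hK.le hκ (hT _ h1) (hT _ h2) ht0
    _ = (T ×ˢ T).card * (K * Real.exp (-κ * t ^ 2)) := by rw [Finset.sum_const, nsmul_eq_mul]
    _ ≤ Real.exp (7 * n) * (K * Real.exp (-κ * t ^ 2)) := by gcongr
    _ = K * Real.exp (7 * n - κ * t ^ 2) := by
        rw [mul_left_comm, ← Real.exp_add]; congr 2; ring
    _ ≤ K * Real.exp (-Real.log (K / δ)) := by
        gcongr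
        have h1 : κ * t ^ 2 = (7 + |Real.log (K / δ)|) * n := by
          rw [ht, mul_pow, Real.sq_sqrt (by positivity), opScale, Real.sq_sqrt (by positivity)]
          field_simp
        rw [h1]
        have h2 := le_abs_self (Real.log (K / δ))
        have h3 := abs_nonneg (Real.log (K / δ))
        nlinarith
    _ = δ := by
        rw [Real.exp_neg, Real.exp_log (by positivity)]; field_simp

end OperatorNorm

/-! ### The Hermitian matrix of a word and its Schatten norm. -/

section

open Matrix

lemma Matrix.IsHermitian.real_smul {ι : Type*} {A : Matrix ι ι ℂ} (hA : A.IsHermitian) (c : ℝ) :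
    (c • A).IsHermitian := by
  rw [IsHermitian, conjTranspose_smul, star_trivial, hA.eq]

section WordMatrix

variable {m n d : ℕ}

/-- The value of a letter at a tuple of matrices; the empty letter stands for the identity. -/
def letterValue (A : Fin m → Matrix (Fin n) (Fin n) ℂ) :
    Option (Fin m ⊕ Fin m) → Matrix (Fin n) (Fin n) ℂ
  | none => 1
  | some (Sum.inl j) => A j
  | some (Sum.inr j) => (A j)ᴴ

/-- The identity padding cancels in differences, leaving only `0`, the differences and their
adjoints. -/
lemma letterValue_sub_induction {p : Matrix (Fin n) (Fin n) ℂ → Prop}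
    {A B : Fin m → Matrix (Fin n) (Fin n) ℂ} (h0 : p 0) (h1 : ∀ j, p (A j - B j))
    (h2 : ∀ j, p (A j - B j)ᴴ) (o : Option (Fin m ⊕ Fin m)) :
    p (letterValue A o - letterValue B o) := by
  rcases o with _ | j | j
  · simpa [letterValue] using h0
  · exact h1 j
  · simpa only [letterValue, ← conjTranspose_sub] using h2 j

/-- The letters of the word `w`, padded to length `d`, at the rescaled matrices. -/
noncomputable def wordBlocks (d : ℕ) (w : List (Fin m ⊕ Fin m))
    (x : Fin m → Matrix (Fin n) (Fin n) ℂ) : ZMod d → Matrix (Fin n) (Fin n) ℂ :=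
  fun k => letterValue (fun j => (√n)⁻¹ • x j) w[k.val]?

variable [NeZero d]

/-- The Hermitian linearization of a word. -/
noncomputable def wordHerm (d : ℕ) [NeZero d] (w : List (Fin m ⊕ Fin m)) (z : ℂ)
    (x : Fin m → Matrix (Fin n) (Fin n) ℂ) : Matrix (ZMod d × Fin n) (ZMod d × Fin n) ℂ :=
  hermPart z (cyclicBlock (wordBlocks d w x))

lemma isHermitian_wordHerm (w : List (Fin m ⊕ Fin m)) (z : ℂ)
    (x : Fin m → Matrix (Fin n) (Fin n) ℂ) : (wordHerm d w z x).IsHermitian :=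
  isHermitian_hermPart _ _

lemma cyclicBlock_add (Y Y' : ZMod d → Matrix (Fin n) (Fin n) ℂ) :
    cyclicBlock (Y + Y') = cyclicBlock Y + cyclicBlock Y' := by
  simp [cyclicBlock, kronecker_add, Finset.sum_add_distrib]

lemma cyclicBlock_smul (c : ℝ) (Y : ZMod d → Matrix (Fin n) (Fin n) ℂ) :
    cyclicBlock (c • Y) = c • cyclicBlock Y := by
  simp [cyclicBlock, kronecker_smul, Finset.smul_sum]

lemma wordHerm_eq_add (w : List (Fin m ⊕ Fin m)) (z : ℂ)
    (x y : Fin m → Matrix (Fin n) (Fin n) ℂ) :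
    wordHerm d w z x = wordHerm d w z y
      + hermPart z (cyclicBlock (wordBlocks d w x - wordBlocks d w y)) := by
  rw [wordHerm, wordHerm, ← hermPart_add, ← cyclicBlock_add]
  congr 2; abel

/-- Because of the identity padding `wordHerm` is affine rather than linear, whence `a + b = 1`. -/
lemma wordHerm_convexComb (w : List (Fin m ⊕ Fin m)) (z : ℂ)
    (x y : Fin m → Matrix (Fin n) (Fin n) ℂ) {a b : ℝ} (hab : a + b = 1) :
    wordHerm d w z (a • x + b • y) = a • wordHerm d w z x + b • wordHerm d w z y := by
  have h : wordBlocks d w (a • x + b • y) = a • wordBlocks d w x + b • wordBlocks d w y := by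
    funext k
    simp only [wordBlocks, Pi.add_apply, Pi.smul_apply]
    rcases w[k.val]? with _ | j | j
    · simp [letterValue, ← add_smul, hab]
    · simp only [letterValue, smul_add, smul_comm (√n)⁻¹]
    · simp only [letterValue, smul_add, smul_comm (√n)⁻¹, conjTranspose_add, conjTranspose_smul,
        star_trivial]
  rw [wordHerm, h, cyclicBlock_add, cyclicBlock_smul, cyclicBlock_smul, hermPart_add,
    hermPart_smul, hermPart_smul, wordHerm, wordHerm]

open scoped Matrix.Norms.Frobenius in
lemma norm_wordHerm_sub_le (w : List (Fin m ⊕ Fin m)) {z : ℂ} (hz : ‖z‖ = 1)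
    (x y : Fin m → Matrix (Fin n) (Fin n) ℂ) :
    ‖wordHerm d w z x - wordHerm d w z y‖ ≤ 2 * d / √n * ‖x - y‖ := by
  rw [wordHerm_eq_add w z x y, add_sub_cancel_left]
  have h0 : 0 ≤ (√n)⁻¹ * ‖x - y‖ := by positivity
  have h1 : ∀ j, ‖(√n)⁻¹ • x j - (√n)⁻¹ • y j‖ ≤ (√n)⁻¹ * ‖x - y‖ := by
    intro j
    rw [← smul_sub, norm_smul, Real.norm_of_nonneg (by positivity)]
    gcongr
    exact norm_le_pi_norm (x - y) j
  refine (norm_hermPart_cyclicBlock_le (τ := (√n)⁻¹ * ‖x - y‖) (fun k => ?_) hz).trans_eq ?_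
  · exact letterValue_sub_induction (p := fun D => ‖D‖ ≤ (√n)⁻¹ * ‖x - y‖) (by simpa using h0) h1
      (fun j => by rw [frobenius_norm_conjTranspose]; exact h1 j) _
  · ring

/-- Split into the value at `A` and the fluctuation. With `q = d - 1` the rescaling turns `n ^ d`
into `n ^ d / n ^ q = n`, so `A` contributes the same order `n^(1/(2q))` as a fluctuation of bounded
rescaled operator norm in dimension `d * n`. -/
lemma evenSchatten_wordHerm_le (hd : 2 ≤ d) (hn : 1 ≤ n) (w : List (Fin m ⊕ Fin m)) {z : ℂ}
    (hz : ‖z‖ = 1) {x A : Fin m → Matrix (Fin n) (Fin n) ℂ} {R τ : ℝ} (hR : 0 ≤ R) (hτ : 0 ≤ τ)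
    (hA : ∀ j, (((A j)ᴴ * A j) ^ (d - 1)).trace.re ≤ R ^ (2 * (d - 1)) * n ^ d)
    (hx : ∀ j, OpBound (x j - A j) (τ * √n)) :
    evenSchatten (d - 1) (wordHerm d w z x) ≤
      (n : ℝ) ^ (1 / (2 * (d - 1 : ℕ) : ℝ)) * (d * (2 * (R + 1)) + d * (2 * (d * τ))) := by
  set q := d - 1 with hq
  have hq1 : 1 ≤ q := by omega
  have hdq : d = q + 1 := by omega
  have hn0 : (0 : ℝ) < n := by exact_mod_cast hn
  have hsq : 0 < √(n : ℝ) := Real.sqrt_pos.2 hn0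
  have hsqinv : ((√(n : ℝ))⁻¹) ^ (2 * q) * n ^ d = n := by
    rw [pow_mul, inv_pow, Real.sq_sqrt hn0.le, hdq, pow_succ, inv_pow, ← mul_assoc,
      inv_mul_cancel₀ (by positivity), one_mul]
  rw [wordHerm_eq_add w z x A]
  refine (evenSchatten_add_le hq1 (isHermitian_wordHerm _ _ _) (isHermitian_hermPart _ _)).trans ?_
  rw [mul_add]
  refine add_le_add ?_ ?_
  -- `R + 1` instead of `R` leaves room for the identity blocks, whose trace is `n`.
  · have hscale : ∀ j, (((((√(n : ℝ))⁻¹ • A j)ᴴ * ((√(n : ℝ))⁻¹ • A j)) ^ q).trace).re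
        ≤ (R + 1) ^ (2 * q) * n := by
      intro j
      rw [conjTranspose_smul, star_trivial, smul_mul_smul_comm, smul_pow, trace_smul,
        Complex.real_smul, Complex.re_ofReal_mul]
      calc _ ≤ (((√(n : ℝ))⁻¹ * (√(n : ℝ))⁻¹) ^ q) * (R ^ (2 * q) * n ^ d) := by
            gcongr; exact hA j
        _ = R ^ (2 * q) * n := by
            rw [← pow_two, ← pow_mul, mul_left_comm, hsqinv]
        _ ≤ _ := by gcongr; linarith
    refine (evenSchatten_hermPart_cyclicBlock_le_of_trace hd hq1 (R := R + 1) (N := n)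
      (by positivity) hn0.le (fun k => ?_) hz).trans_eq (by ring)
    simp only [wordBlocks]
    rcases w[k.val]? with _ | j | j
    · simp only [letterValue, conjTranspose_one, mul_one, one_pow, trace_one, Fintype.card_fin,
        Complex.natCast_re]
      exact le_mul_of_one_le_left hn0.le (one_le_pow₀ (by linarith))
    · exact hscale j
    · simp only [letterValue, conjTranspose_conjTranspose]
      rw [trace_mul_pow_comm]
      exact hscale j
  · have hop : ∀ j, OpBound ((√(n : ℝ))⁻¹ • x j - (√(n : ℝ))⁻¹ • A j) τ := by
      intro j
      rw [← smul_sub]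
      have := (hx j).smul (c := (√(n : ℝ))⁻¹) (by positivity)
      rwa [mul_left_comm, inv_mul_cancel₀ hsq.ne', mul_one] at this
    refine (evenSchatten_hermPart_cyclicBlock_le hq1 hτ (fun k =>
      letterValue_sub_induction (p := fun D => OpBound D τ) (opBound_zero hτ) hop
        (fun j => (hop j).conjTranspose) _) hz).trans ?_
    have hd1 : (1 : ℝ) ≤ d := by exact_mod_cast (by omega : 1 ≤ d)
    rw [Fintype.card_fin, Real.mul_rpow (by positivity) hn0.le]
    have h1 : (d : ℝ) ^ (1 / (2 * q : ℝ)) ≤ d := by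
      refine (Real.rpow_le_rpow_of_exponent_le hd1 ?_).trans_eq (Real.rpow_one _)
      have : (1 : ℝ) ≤ q := by exact_mod_cast hq1
      rw [div_le_one (by positivity)]; linarith
    calc _ ≤ (d : ℝ) * (n : ℝ) ^ (1 / (2 * q : ℝ)) * (2 * (d * τ)) := by gcongr
      _ = _ := by ring

end WordMatrix

/-! ### Concentration of the Schatten norm, the slope and the convex constituents. -/

section WordTail

open scoped Matrix.Norms.Frobenius

variable {m n d : ℕ} [NeZero d] {P : Measure (Fin m → Matrix (Fin n) (Fin n) ℂ)}
  [IsProbabilityMeasure P] {K κ : ℝ}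

/-- The norm is convex and `2d/√n`-Lipschitz, so it concentrates about its mean; the bound by `D`
with probability at least `3/4` then keeps the mean below `D` plus one deviation scale. -/
lemma tail_evenSchatten_wordHerm (h : MeanConcentration P K κ) (hK : 0 < K) (hκ : 0 < κ)
    (hd : 2 ≤ d) (hn : 1 ≤ n) (w : List (Fin m ⊕ Fin m)) {z : ℂ} (hz : ‖z‖ = 1) {D : ℝ}
    (hD : P.real {x | ¬ evenSchatten (d - 1) (wordHerm d w z x) ≤ D} ≤ 1 / 4) {s : ℝ}
    (hs : 0 < s) :
    P.real {x | D + 2 * d * √((1 + |Real.log (4 * K)|) / κ) + s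
      ≤ evenSchatten (d - 1) (wordHerm d w z x)} ≤ K * Real.exp (-(κ / (2 * d) ^ 2) * (n * s ^ 2)) := by
  have hq1 : 1 ≤ d - 1 := by omega
  have hn1 : (1 : ℝ) ≤ n := by exact_mod_cast hn
  have hn0 : (0 : ℝ) < n := by linarith
  have hd0 : (0 : ℝ) < d := by exact_mod_cast (by omega : 0 < d)
  have hsq : 0 < √(n : ℝ) := Real.sqrt_pos.2 hn0
  set N : (Fin m → Matrix (Fin n) (Fin n) ℂ) → ℝ :=
    fun x => evenSchatten (d - 1) (wordHerm d w z x) with hN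
  have hH := fun x : Fin m → Matrix (Fin n) (Fin n) ℂ => isHermitian_wordHerm (d := d) w z x
  have hNc : ConvexOn ℝ Set.univ N := by
    refine ⟨convex_univ, fun x _ y _ a b ha hb hab => ?_⟩
    simp only [hN]
    rw [wordHerm_convexComb w z x y hab]
    refine (evenSchatten_add_le hq1 ((hH x).real_smul a) ((hH y).real_smul b)).trans ?_
    rw [evenSchatten_smul hq1 (hH x) ha, evenSchatten_smul hq1 (hH y) hb]
    rfl
  have hNL : ∀ x y, N x - N y ≤ 2 * d / √n * ‖x - y‖ := fun x y =>
    (evenSchatten_sub_le hq1 (hH x) (hH y)).trans (norm_wordHerm_sub_le w hz x y)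
  have htail := (h.integrable hK.le hκ hNc (by positivity) hNL).2
  have hexp : ∀ t, -κ * (t / (2 * d / √n)) ^ 2 = -(κ / (2 * d) ^ 2) * (n * t ^ 2) := by
    intro t
    rw [div_div_eq_mul_div, div_pow, mul_pow, Real.sq_sqrt hn0.le]; field_simp
  set s₀ : ℝ := 2 * d * √((1 + |Real.log (4 * K)|) / κ) with hs₀
  have hs₀pos : 0 < s₀ := by positivity
  have hs₀tail : P.real {x | s₀ ≤ |N x - ∫ y, N y ∂P|} ≤ 1 / 4 := by
    refine (htail s₀ hs₀pos).trans ?_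
    rw [hexp]
    have h1 : (κ / (2 * d) ^ 2) * s₀ ^ 2 = 1 + |Real.log (4 * K)| := by
      rw [hs₀, mul_pow (2 * (d : ℝ)) (√_), Real.sq_sqrt (by positivity)]; field_simp
    have h2 : Real.log (4 * K) ≤ κ / (2 * d) ^ 2 * (n * s₀ ^ 2) := by
      have h3 := le_abs_self (Real.log (4 * K))
      have h4 := abs_nonneg (Real.log (4 * K))
      rw [mul_left_comm, h1]; nlinarith
    calc _ ≤ K * Real.exp (-Real.log (4 * K)) := by gcongr; linarith
      _ = 1 / 4 := by rw [Real.exp_neg, Real.exp_log (by positivity)]; field_simp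
  have hmean : ∫ y, N y ∂P ≤ D + s₀ := by
    have hex : ∃ x, x ∉ {x | ¬ N x ≤ D} ∪ {x | s₀ ≤ |N x - ∫ y, N y ∂P|} := by
      by_contra hcon
      have h1 : P.real ({x | ¬ N x ≤ D} ∪ {x | s₀ ≤ |N x - ∫ y, N y ∂P|}) = 1 := by
        rw [Set.eq_univ_of_forall fun x => by_contra fun hx => hcon ⟨x, hx⟩, probReal_univ]
      have h2 := measureReal_union_le (μ := P) {x | ¬ N x ≤ D} {x | s₀ ≤ |N x - ∫ y, N y ∂P|}
      linarith
    obtain ⟨x, hx⟩ := hex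
    simp only [Set.mem_union, Set.mem_ofPred_eq, not_or, not_le] at hx
    have := (abs_lt.1 hx.2).1
    linarith [not_lt.1 hx.1]
  rw [← hexp]
  refine (measureReal_mono fun x hx => ?_).trans (htail s hs)
  simp only [Set.mem_ofPred_eq] at hx ⊢
  refine le_trans ?_ (le_abs_self _)
  linarith

/-- The slope of `x ↦ posPartTrace d (wordHerm d w z x)`, up to a constant. -/
noncomputable def wordSlope (d : ℕ) [NeZero d] (w : List (Fin m ⊕ Fin m)) (z : ℂ)
    (x : Fin m → Matrix (Fin n) (Fin n) ℂ) : ℝ :=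
  √(∑ i, (isHermitian_wordHerm (d := d) w z x).eigenvalues i ^ (2 * (d - 1)))

/-- The slope is the `(d-1)`-st power of the Schatten norm. That norm is at most a constant times
`n^(1/(2(d-1))) + s` off the exceptional event, and the power of the first term is `√n`. -/
lemma tail_wordSlope (h : MeanConcentration P K κ) (hK : 0 < K) (hκ : 0 < κ) (hn : 1 ≤ n)
    (w : List (Fin m ⊕ Fin m)) {z : ℂ} (hz : ‖z‖ = 1) {D : ℝ} (hD0 : 0 ≤ D)
    (hD : 2 ≤ d → P.real {x | ¬ evenSchatten (d - 1) (wordHerm d w z x)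
      ≤ (n : ℝ) ^ (1 / (2 * (d - 1 : ℕ) : ℝ)) * D} ≤ 1 / 4) {s : ℝ} (hs : 0 < s) :
    P.real {x | (2 * (D + 2 * d * √((1 + |Real.log (4 * K)|) / κ) + 1)) ^ (d - 1)
        * (√n + s ^ (d - 1)) < wordSlope d w z x}
      ≤ K * Real.exp (-(κ / (2 * d) ^ 2) * (n * s ^ 2)) := by
  have hn1 : (1 : ℝ) ≤ n := by exact_mod_cast hn
  have hn0 : (0 : ℝ) < n := by linarith
  set s₀ : ℝ := 2 * d * √((1 + |Real.log (4 * K)|) / κ) with hs₀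
  have hs₀0 : 0 ≤ s₀ := by positivity
  have hd1 : 1 ≤ d := NeZero.one_le
  rcases hd1.eq_or_lt with hd | hd
  -- For `d = 1` every eigenvalue enters with exponent `0`, so the slope is the constant `√n`.
  · have : {x : Fin m → Matrix (Fin n) (Fin n) ℂ | (2 * (D + s₀ + 1)) ^ (d - 1)
        * (√n + s ^ (d - 1)) < wordSlope d w z x} = ∅ := by
      ext x
      simp only [Set.mem_ofPred_eq, Set.mem_empty_iff_false, iff_false, not_lt, wordSlope]
      have h0 : d - 1 = 0 := by omega
      simp only [h0, mul_zero, pow_zero, one_mul, Finset.sum_const, Finset.card_univ,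
        Fintype.card_prod, ZMod.card, Fintype.card_fin, nsmul_eq_mul, mul_one]
      rw [← hd, one_mul]
      linarith
    rw [this, measureReal_empty]
    positivity
  · have hd2 : 2 ≤ d := hd
    refine le_trans (measureReal_mono fun x hx => ?_)
      (tail_evenSchatten_wordHerm h hK hκ hd2 hn w hz (hD hd2) hs)
    simp only [Set.mem_ofPred_eq] at hx ⊢
    by_contra! hcon
    have hq1 : 1 ≤ d - 1 := by omega
    set q := d - 1 with hq
    have hq0 : (q : ℝ) ≠ 0 := by positivity
    set N := evenSchatten q (wordHerm d w z x) with hN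
    have hN0 : 0 ≤ N := evenSchatten_nonneg q (isHermitian_wordHerm w z x)
    have hslope : wordSlope d w z x = N ^ q := by
      rw [wordSlope, ← hq, ← evenSchatten_pow hq1, mul_comm 2 q, pow_mul, Real.sqrt_sq (by positivity)]
    set r : ℝ := (n : ℝ) ^ (1 / (2 * q : ℝ)) with hr
    have hr1 : 1 ≤ r := Real.one_le_rpow hn1 (by positivity)
    have hrq : r ^ q = √n := by
      rw [hr, ← Real.rpow_natCast, ← Real.rpow_mul hn0.le, Real.sqrt_eq_rpow]
      congr 1; field_simp
    have hle : N ≤ (D + s₀ + 1) * (r + s) := by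
      have h1 : s₀ ≤ s₀ * r := le_mul_of_one_le_right hs₀0 hr1
      have h2 : 0 ≤ (D + s₀) * s := by positivity
      nlinarith
    have hfin : N ^ q ≤ (2 * (D + s₀ + 1)) ^ q * (√n + s ^ q) := by
      calc N ^ q ≤ ((D + s₀ + 1) * (r + s)) ^ q := by gcongr
        _ = (D + s₀ + 1) ^ q * (r + s) ^ q := mul_pow _ _ _
        _ ≤ (D + s₀ + 1) ^ q * (2 ^ (q - 1) * (r ^ q + s ^ q)) := by
            gcongr
            exact add_pow_le (by positivity) hs.le q
        _ ≤ (D + s₀ + 1) ^ q * (2 ^ q * (r ^ q + s ^ q)) := by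
            gcongr
            · norm_num
            · omega
        _ = _ := by rw [hrq, mul_pow]; ring
    rw [hslope] at hx
    linarith

lemma exists_centre_posPartTrace (h : MeanConcentration P K κ) (hK : 0 < K) (hκ : 0 < κ)
    (w : List (Fin m ⊕ Fin m)) {z : ℂ} (hz : ‖z‖ = 1) {L : ℝ} (hL : 0 < L) :
    ∃ a, ∀ t, 0 < t →
      P.real {x | t ≤ |posPartTrace d (isHermitian_wordHerm (d := d) w z x) - a|} ≤
        P.real {x | L < 2 * d / √n * (d * wordSlope d w z x)}
          + K * Real.exp (-κ * (t / L) ^ 2) := by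
  have hH := fun x : Fin m → Matrix (Fin n) (Fin n) ℂ => isHermitian_wordHerm (d := d) w z x
  have hd1 : 1 ≤ d := NeZero.one_le
  refine h.exists_tail_of_tangents hK.le hκ
    (fun x => posPartTrace d (isHermitian_wordHerm (d := d) w z x)) _
    (fun x y => posPartTrace d (hH x) + ∑ i, posPartSlope d ((hH x).eigenvalues i)
      * diagConj (hH x).eigenvectorUnitary (wordHerm d w z y - wordHerm d w z x) i)
    (fun x y => posPartTrace_tangent hd1 (hH x) (hH y)) ?_ ?_ ?_ hL
  · intro x
    simp [diagConj]
  · intro x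
    refine ⟨convex_univ, fun y _ y' _ a b _ _ hab => le_of_eq ?_⟩
    have h1 : wordHerm d w z (a • y + b • y') - wordHerm d w z x
        = a • (wordHerm d w z y - wordHerm d w z x) + b • (wordHerm d w z y' - wordHerm d w z x) := by
      rw [wordHerm_convexComb w z y y' hab, smul_sub, smul_sub]
      have : wordHerm d w z x = a • wordHerm d w z x + b • wordHerm d w z x := by
        rw [← add_smul, hab, one_smul]
      nth_rewrite 1 [this]
      abel
    have h2 : posPartTrace d (hH x) = a * posPartTrace d (hH x) + b * posPartTrace d (hH x) := by
      rw [← add_mul, hab, one_mul]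
    simp only [h1, diagConj_add, diagConj_smul, smul_eq_mul, mul_add, Finset.sum_add_distrib,
      Finset.mul_sum, mul_left_comm _ a, mul_left_comm _ b]
    linarith
  · intro x y y'
    have h1 := sum_posPartSlope_mul_le d (hH x) ((hH y).sub (hH y'))
    have h2 := norm_wordHerm_sub_le (d := d) w hz y y'
    have h3 : wordHerm d w z y - wordHerm d w z y' = (wordHerm d w z y - wordHerm d w z x)
        - (wordHerm d w z y' - wordHerm d w z x) := by abel
    have h4 : ∑ i, posPartSlope d ((hH x).eigenvalues i)
        * diagConj (hH x).eigenvectorUnitary (wordHerm d w z y - wordHerm d w z y') i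
        = ∑ i, posPartSlope d ((hH x).eigenvalues i)
          * diagConj (hH x).eigenvectorUnitary (wordHerm d w z y - wordHerm d w z x) i
        - ∑ i, posPartSlope d ((hH x).eigenvalues i)
          * diagConj (hH x).eigenvectorUnitary (wordHerm d w z y' - wordHerm d w z x) i := by
      rw [h3]
      simp only [diagConj_sub _ (wordHerm d w z y - wordHerm d w z x), mul_sub,
        Finset.sum_sub_distrib]
    have h5 : (d : ℝ) * wordSlope d w z x * ‖wordHerm d w z y - wordHerm d w z y'‖
        ≤ d * wordSlope d w z x * (2 * d / √n * ‖y - y'‖) :=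
      mul_le_mul_of_nonneg_left h2 (mul_nonneg (by positivity) (Real.sqrt_nonneg _))
    rw [h4] at h1
    simp only [wordSlope] at h5 ⊢
    linarith

/-- Here `t = s ^ d`. If `s ^ (d - 1) ≤ √n` the denominator is at most `2` and the `t ^ 2` term
suffices; otherwise the quotient is at least `√n * s / 2` and the other term does. -/
lemma rate_le_four_mul_sq (hn : 1 ≤ n) {s : ℝ} (hs : 0 < s) :
    rate d n (s ^ d) ≤ 4 * (s ^ d / (1 + s ^ (d - 1) / √n)) ^ 2 ∧
      rate d n (s ^ d) ≤ n * s ^ 2 := by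
  have hn0 : (0 : ℝ) < n := by exact_mod_cast hn
  have hd1 : 1 ≤ d := NeZero.one_le
  have hd0 : (d : ℝ) ≠ 0 := by positivity
  have hpow : (s ^ d) ^ (2 / (d : ℝ)) = s ^ 2 := by
    rw [← Real.rpow_natCast, ← Real.rpow_mul hs.le, ← Real.rpow_natCast s 2]
    congr 1; push_cast; field_simp
  have h2 : rate d n (s ^ d) ≤ n * s ^ 2 := by
    rw [rate, hpow]; exact min_le_right _ _
  refine ⟨?_, h2⟩
  set b : ℝ := s ^ (d - 1) / √n with hb
  have hb0 : 0 < b := by positivity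
  rcases le_total b 1 with h1 | h1
  · refine (rate_le_sq d n _).trans ?_
    rw [div_pow, ← mul_div_assoc, le_div_iff₀ (by positivity), mul_comm]
    gcongr
    nlinarith
  · have h3 : (s ^ d) ^ 2 = n * s ^ 2 * b ^ 2 := by
      rw [hb, div_pow, Real.sq_sqrt hn0.le]
      obtain ⟨e, rfl⟩ := Nat.exists_eq_add_of_le' hd1
      rw [Nat.add_sub_cancel]
      field_simp
      ring
    refine h2.trans ?_
    rw [div_pow, h3, ← mul_div_assoc, le_div_iff₀ (by positivity)]
    have : (1 + b) ^ 2 ≤ 4 * b ^ 2 := by nlinarith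
    calc (n : ℝ) * s ^ 2 * (1 + b) ^ 2 ≤ n * s ^ 2 * (4 * b ^ 2) := by gcongr
      _ = _ := by ring

end WordTail

open scoped Matrix.Norms.Frobenius in
/-- Concentration of the convex constituents of a trace of a word. -/
lemma exists_tailBound_posPartTrace (d : ℕ) [NeZero d] {K κ D : ℝ} (hK : 0 < K) (hκ : 0 < κ)
    (hD0 : 0 ≤ D) :
    ∃ C c : ℝ, 0 < C ∧ 0 < c ∧ ∀ (m n : ℕ) (_ : 1 ≤ n)
      (P : Measure (Fin m → Matrix (Fin n) (Fin n) ℂ)) (_ : IsProbabilityMeasure P)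
      (_ : MeanConcentration P K κ) (w : List (Fin m ⊕ Fin m)) (z : ℂ) (_ : ‖z‖ = 1)
      (_ : 2 ≤ d → P.real {x | ¬ evenSchatten (d - 1) (wordHerm d w z x)
        ≤ (n : ℝ) ^ (1 / (2 * (d - 1 : ℕ) : ℝ)) * D} ≤ 1 / 4),
      ∃ a, TailBound P (fun x => posPartTrace d (isHermitian_wordHerm (d := d) w z x)) a d n C c := by
  have hd1 : 1 ≤ d := NeZero.one_le
  have hd0 : (0 : ℝ) < d := by exact_mod_cast hd1
  set B : ℝ := (2 * (D + 2 * d * √((1 + |Real.log (4 * K)|) / κ) + 1)) ^ (d - 1) with hB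
  have hB0 : 0 < B := by positivity
  set Λ : ℝ := 2 * d * (d * B) with hΛ
  have hΛ0 : 0 < Λ := by positivity
  -- The first entry serves the tail of the slope, the second the tail of the truncated function;
  -- its `4` is that of `rate_le_four_mul_sq`.
  set c₀ : ℝ := min (κ / (2 * d) ^ 2) (κ / (4 * Λ ^ 2)) with hc₀
  have hc₀0 : 0 < c₀ := lt_min (by positivity) (by positivity)
  refine ⟨2 * K + Real.exp (c₀ / 9 * (3 * centreRadius d (2 * K) c₀) ^ 2), c₀ / 9, by positivity,
    by positivity, fun m n hn P _ h w z hz hS => ?_⟩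
  refine exists_tailBound_of_centres hd1 hn (by positivity) hc₀0 fun t ht => ?_
  have hn0 : (0 : ℝ) < n := by exact_mod_cast hn
  have hsq : 0 < √(n : ℝ) := Real.sqrt_pos.2 hn0
  set s : ℝ := t ^ (1 / (d : ℝ)) with hs
  have hs0 : 0 < s := by positivity
  have hsd : s ^ d = t := by
    rw [hs, ← Real.rpow_natCast, ← Real.rpow_mul ht.le, one_div_mul_cancel hd0.ne', Real.rpow_one]
  -- The truncation level grows with `t` to balance the two errors, so the centre depends on `t` as
  -- well.
  set L : ℝ := Λ * (1 + s ^ (d - 1) / √n) with hL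
  have hL0 : 0 < L := by positivity
  obtain ⟨a, ha⟩ := exists_centre_posPartTrace (d := d) h hK hκ w hz hL0
  refine ⟨a, (ha t ht).trans ?_⟩
  obtain ⟨hr1, hr2⟩ := rate_le_four_mul_sq (d := d) hn hs0
  rw [hsd] at hr1 hr2
  have hrn := rate_nonneg d n ht.le
  have hset : {x : Fin m → Matrix (Fin n) (Fin n) ℂ | L < 2 * d / √n * (d * wordSlope d w z x)}
      ⊆ {x | B * (√n + s ^ (d - 1)) < wordSlope d w z x} := by
    intro x hx
    simp only [Set.mem_ofPred_eq] at hx ⊢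
    have h1 : L = 2 * d / √n * (d * (B * (√n + s ^ (d - 1)))) := by
      rw [hL, hΛ]; field_simp
    rw [h1] at hx
    exact lt_of_mul_lt_mul_left (lt_of_mul_lt_mul_left hx (by positivity)) hd0.le
  have h1 : P.real {x : Fin m → Matrix (Fin n) (Fin n) ℂ |
      L < 2 * d / √n * (d * wordSlope d w z x)} ≤ K * Real.exp (-c₀ * rate d n t) := by
    refine (measureReal_mono hset).trans ((tail_wordSlope h hK hκ hn w hz hD0 hS hs0).trans ?_)
    refine mul_le_mul_of_nonneg_left (Real.exp_le_exp.2 ?_) hK.le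
    have h2 : c₀ * rate d n t ≤ κ / (2 * d) ^ 2 * (n * s ^ 2) :=
      mul_le_mul (min_le_left _ _) hr2 hrn (by positivity)
    linarith
  have h2 : K * Real.exp (-κ * (t / L) ^ 2) ≤ K * Real.exp (-c₀ * rate d n t) := by
    refine mul_le_mul_of_nonneg_left (Real.exp_le_exp.2 ?_) hK.le
    have h3 : c₀ * rate d n t ≤ κ / (4 * Λ ^ 2) * (4 * (t / (1 + s ^ (d - 1) / √n)) ^ 2) :=
      mul_le_mul (min_le_right _ _) hr1 hrn (by positivity)
    have h4 : κ / (4 * Λ ^ 2) * (4 * (t / (1 + s ^ (d - 1) / √n)) ^ 2) = κ * (t / L) ^ 2 := by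
      rw [hL]; field_simp
    linarith
  linarith

/-! ### Expansion of the trace statistic into convex constituents. -/

section Expansion

variable {m n d : ℕ}

lemma traceStatistic_eq_sum {Ω : Type*} (Q : NCStarPolynomial m)
    (X : Fin m → Ω → Matrix (Fin n) (Fin n) ℂ) (ω : Ω) :
    traceStatistic Q X ω = ∑ w ∈ Q.coeff.support, Q.coeff w *
      ((w.toList.map fun a => letterValue (fun j => (√n)⁻¹ • X j ω) (some a)).prod).trace := by
  have h : ∀ a, letterValue (fun j => (√n)⁻¹ • X j ω) (some a)
      = Sum.elim (fun j => (√n)⁻¹ • X j ω) (fun j => ((√n)⁻¹ • X j ω)ᴴ) a := by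
    rintro (j | j) <;> rfl
  simp only [traceStatistic, NCStarPolynomial.eval, MonoidAlgebra.lift_apply, Finsupp.sum,
    trace_sum, trace_smul, smul_eq_mul, FreeMonoid.lift_apply, h]

lemma measurable_traceStatistic {Ω : Type*} [MeasurableSpace Ω] (Q : NCStarPolynomial m)
    {X : Fin m → Ω → Matrix (Fin n) (Fin n) ℂ} (hX : ∀ j, Measurable (X j)) :
    Measurable (traceStatistic Q X) := by
  have hentry : ∀ j a b, Measurable fun ω => X j ω a b := fun j a b =>
    (measurable_pi_apply b).comp
      ((measurable_pi_apply (X := fun _ : Fin n => Fin n → ℂ) a).comp (hX j))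
  have hletter : ∀ o a b, Measurable fun ω => letterValue (fun j => (√n)⁻¹ • X j ω) o a b := by
    rintro (_ | j | j) a b
    · exact measurable_const
    · exact (hentry j a b).const_smul (√n)⁻¹
    · simp only [letterValue, conjTranspose_apply, Matrix.smul_apply]
      exact Complex.continuous_conj.measurable.comp ((hentry j b a).const_smul (√n)⁻¹)
  have hprod : ∀ (l : List (Fin m ⊕ Fin m)) a b, Measurable fun ω =>
      ((l.map fun a => letterValue (fun j => (√n)⁻¹ • X j ω) (some a)).prod) a b := by
    intro l
    induction l with
    | nil => intro a b; simp only [List.map_nil, List.prod_nil]; exact measurable_const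
    | cons c l ih =>
      intro a b
      simp only [List.map_cons, List.prod_cons, mul_apply]
      exact Finset.measurable_sum _ fun k _ => (hletter _ a k).mul (ih k b)
  have : traceStatistic Q X = fun ω => ∑ w ∈ Q.coeff.support, Q.coeff w *
      ((w.toList.map fun a => letterValue (fun j => (√n)⁻¹ • X j ω) (some a)).prod).trace :=
    funext fun ω => traceStatistic_eq_sum Q X ω
  rw [this]
  refine Finset.measurable_sum _ fun w _ => Measurable.const_mul ?_ _
  exact Finset.measurable_sum _ fun k _ => hprod _ k k

variable [NeZero d]

lemma posPartTrace_congr {ι : Type*} [Fintype ι] [DecidableEq ι] (d : ℕ) {A B : Matrix ι ι ℂ}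
    (hA : A.IsHermitian) (hB : B.IsHermitian) (h : A = B) :
    posPartTrace d hA = posPartTrace d hB := by
  subst h; rfl

/-- The coefficients in the expansion of the trace of a word. -/
noncomputable def expansionCoeff (d : ℕ) (p : ℕ × ℕ) : ℂ :=
  ((Complex.exp (2 * Real.pi * Complex.I / (2 * d + 1 : ℕ)) ^ p.1)⁻¹) ^ d
    * ((-1) ^ d) ^ p.2 / ((2 * d + 1 : ℕ) * d)

/-- The phases in the expansion of the trace of a word. -/
noncomputable def expansionPhase (d : ℕ) (p : ℕ × ℕ) : ℂ :=
  (-1) ^ p.2 * Complex.exp (2 * Real.pi * Complex.I / (2 * d + 1 : ℕ)) ^ p.1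

lemma norm_root_of_unity (d : ℕ) :
    ‖Complex.exp (2 * Real.pi * Complex.I / (2 * d + 1 : ℕ))‖ = 1 :=
  (Complex.isPrimitiveRoot_exp (2 * d + 1) (by omega)).norm'_eq_one (by omega)

lemma norm_expansionPhase (d : ℕ) (p : ℕ × ℕ) : ‖expansionPhase d p‖ = 1 := by
  rw [expansionPhase, norm_mul, norm_pow, norm_pow, norm_root_of_unity]
  simp

lemma norm_expansionCoeff_le (p : ℕ × ℕ) : ‖expansionCoeff d p‖ ≤ 1 := by
  rw [expansionCoeff, norm_div, norm_mul, norm_pow, norm_inv, norm_pow, norm_root_of_unity,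
    norm_pow, norm_pow, norm_neg, norm_one]
  simp only [one_pow, inv_one, mul_one, norm_mul, Complex.norm_natCast]
  have h1 : (1 : ℝ) ≤ d := by exact_mod_cast NeZero.one_le
  have h2 : (1 : ℝ) ≤ (2 * d + 1 : ℕ) := by exact_mod_cast (by omega : 1 ≤ 2 * d + 1)
  rw [div_le_one (by positivity)]
  nlinarith

/-- The denominators `d` and `2d + 1` come from the cyclic block and from the average over roots of
unity. The second index chooses the phase `±ζ ^ i`, since negating the phase negates the Hermitian
matrix and so exchanges its positive and negative parts. -/
lemma trace_word_eq_sum (w : List (Fin m ⊕ Fin m)) (hw : w.length ≤ d)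
    (x : Fin m → Matrix (Fin n) (Fin n) ℂ) :
    ((w.map fun a => letterValue (fun j => (√n)⁻¹ • x j) (some a)).prod).trace
      = ∑ p ∈ Finset.range (2 * d + 1) ×ˢ Finset.range 2, expansionCoeff d p
        * (posPartTrace d (isHermitian_wordHerm (d := d) w (expansionPhase d p) x) : ℂ) := by
  have hd1 : 1 ≤ d := NeZero.one_le
  have hd0 : (d : ℂ) ≠ 0 := by exact_mod_cast NeZero.ne d
  have hM0 : ((2 * d + 1 : ℕ) : ℂ) ≠ 0 := by exact_mod_cast (by omega : 2 * d + 1 ≠ 0)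
  set ζ : ℂ := Complex.exp (2 * Real.pi * Complex.I / (2 * d + 1 : ℕ)) with hζ
  have hprim : IsPrimitiveRoot ζ (2 * d + 1) := Complex.isPrimitiveRoot_exp _ (by omega)
  have h1 := cyclicProd_eq_list_prod (letterValue fun j => (√n)⁻¹ • x j) rfl (wordBlocks d w x)
    d 0 w (fun i hi => by
      rw [zero_add, wordBlocks, ZMod.val_natCast_of_lt hi]) hw
  have h2 := sum_trace_hermPart_pow (cyclicBlock (wordBlocks d w x)) rfl hprim
  rw [trace_cyclicBlock_pow, h1] at h2
  have h3 : ∀ z, ((hermPart z (cyclicBlock (wordBlocks d w x))) ^ d).trace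
      = (posPartTrace d (isHermitian_wordHerm (d := d) w z x) : ℂ)
        + (-1) ^ d * (posPartTrace d (isHermitian_wordHerm (d := d) w (-z) x) : ℂ) := by
    intro z
    have h4 := trace_pow_eq_posPartTrace hd1 (isHermitian_wordHerm (d := d) w z x)
    rw [posPartTrace_congr d (isHermitian_wordHerm (d := d) w z x).neg
      (isHermitian_wordHerm (d := d) w (-z) x) (hermPart_neg_left _ _).symm] at h4
    exact h4
  simp only [h3] at h2
  rw [Finset.sum_product]
  simp only [Finset.sum_range_succ, Finset.sum_range_zero, zero_add, expansionCoeff,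
    expansionPhase, ← hζ, pow_zero, pow_one, one_mul, mul_one, neg_one_mul]
  -- Expanding the sum over `range 2` also split off the last root of unity; it is put back here.
  rw [← Finset.sum_range_succ (fun i => (ζ ^ i)⁻¹ ^ d / (↑(2 * d + 1) * ↑d)
      * (posPartTrace d (isHermitian_wordHerm (d := d) w (ζ ^ i) x) : ℂ)
    + (ζ ^ i)⁻¹ ^ d * (-1) ^ d / (↑(2 * d + 1) * ↑d)
      * (posPartTrace d (isHermitian_wordHerm (d := d) w (-ζ ^ i) x) : ℂ))]
  refine mul_left_cancel₀ (mul_ne_zero hM0 hd0) ?_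
  rw [mul_assoc, ← h2, Finset.mul_sum]
  refine Finset.sum_congr rfl fun i _ => ?_
  field_simp

end Expansion

/-! ### Assembly of the concentration inequality. -/

/-- A word of length at most `d` is determined by its `d` padded letters. This makes the number of
terms depend on `m` and `d` only. -/
lemma card_support_le {m d : ℕ} [NeZero d] {Q : NCStarPolynomial m} (hQ : Q.DegreeLE d) :
    Q.coeff.support.card ≤ Fintype.card (ZMod d → Option (Fin m ⊕ Fin m)) := by
  rw [← Finset.card_univ]
  refine Finset.card_le_card_of_injOn (fun w k => w.toList[k.val]?) (fun _ _ => Finset.mem_univ _) ?_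
  intro w hw w' hw' h
  have hl : w.toList.length ≤ d := hQ w (Finsupp.mem_support_iff.1 hw)
  have hl' : w'.toList.length ≤ d := hQ w' (Finsupp.mem_support_iff.1 hw')
  refine FreeMonoid.toList.injective (List.ext_getElem? fun i => ?_)
  rcases lt_or_ge i d with hi | hi
  · have := congrFun h (i : ZMod d)
    simpa only [ZMod.val_natCast_of_lt hi] using this
  · rw [List.getElem?_eq_none (hl.trans hi), List.getElem?_eq_none (hl'.trans hi)]

open scoped Matrix.Norms.Frobenius in
lemma meanMatrix_eq_map {Ω : Type*} [MeasurableSpace Ω] (μ : Measure Ω) {n : ℕ}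
    {X : Ω → Matrix (Fin n) (Fin n) ℂ} (hX : Measurable X) :
    (Matrix.of fun i j => ∫ y, y i j ∂(μ.map X)) = meanMatrix μ X := by
  ext i j
  have hm : Measurable fun x : Matrix (Fin n) (Fin n) ℂ => x i j :=
    (measurable_pi_apply j).comp (measurable_pi_apply (X := fun _ : Fin n => Fin n → ℂ) i)
  rw [Matrix.of_apply, integral_map hX.aemeasurable hm.aestronglyMeasurable]
  rfl

/-- An inequality valid for arbitrary `s`, so the events about eigenvalues and operator norms need
no measurability proof. -/
lemma measureReal_preimage_le_map {Ω V : Type*} [MeasurableSpace Ω] [MeasurableSpace V]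
    {μ : Measure Ω} [IsProbabilityMeasure μ] {X : Ω → V} (hX : Measurable X) (s : Set V) :
    μ.real (X ⁻¹' s) ≤ (μ.map X).real s := by
  have := Measure.isProbabilityMeasure_map (μ := μ) hX.aemeasurable
  exact ENNReal.toReal_mono (measure_ne_top _ _) (Measure.le_map_apply hX.aemeasurable s)

open scoped Matrix.Norms.Frobenius in
/-- The concentration inequality under a bound on the Schatten norms of the means. -/
lemma exists_concentration (m d : ℕ) (hd : 1 ≤ d) (K κ : ℝ) (hK : 0 < K) (hκ : 0 < κ) (C₀ : ℝ)
    (hC₀ : 0 < C₀) : ∃ C c : ℝ, 0 < C ∧ 0 < c ∧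
      ∀ (n : ℕ) (Ω : Type*) [MeasurableSpace Ω] (μ : Measure Ω) [IsProbabilityMeasure μ]
        (X : Fin m → Ω → Matrix (Fin n) (Fin n) ℂ),
        (∀ j, Measurable (X j)) → iIndepFun X μ →
        (∀ j, HSConvexConcentration μ (X j) K κ) →
        (2 ≤ d → ∀ j, schattenNorm (2 * ((d : ℝ) - 1)) (meanMatrix μ (X j))
          ≤ C₀ * (n : ℝ) ^ ((d : ℝ) / (2 * ((d : ℝ) - 1)))) →
        ∀ P : NCStarPolynomial m, P.DegreeLE d → P.Normalized →
          Integrable (traceStatistic P X) μ ∧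
          ∀ t : ℝ, 0 < t →
            μ.real {ω | t ≤ ‖traceStatistic P X ω - ∫ ω', traceStatistic P X ω' ∂μ‖}
              ≤ C * Real.exp (-c * min (t ^ 2) (n * t ^ (2 / (d : ℝ)))) := by
  have : NeZero d := ⟨by omega⟩
  set K₁ := meanConstant K κ with hK₁
  have hK₁0 : 0 < K₁ := meanConstant_pos hK.le
  -- The union over `m` matrices of events of probability `1 / (4 * (m + 1))` stays below `1 / 4`;
  -- `m + 1` also covers `m = 0`.
  set τ : ℝ := 4 * opScale K₁ (κ / 4) (1 / (4 * (m + 1))) with hτ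
  have hτ0 : 0 ≤ τ := by unfold τ opScale; positivity
  set D : ℝ := d * (2 * (C₀ + 1)) + d * (2 * (d * τ)) with hD
  obtain ⟨C₁, c₁, hC₁, hc₁, hmain⟩ := exists_tailBound_posPartTrace d
    (K := 2 ^ m * K₁) (κ := κ / 4 / 4 ^ m) (D := D) (by positivity) (by positivity) (by positivity)
  -- Number of padded words times the `2d + 1` roots of unity and two signs.
  set B : ℕ := Fintype.card (ZMod d → Option (Fin m ⊕ Fin m)) * ((2 * d + 1) * 2) with hB
  have hB1 : 1 ≤ B := Nat.one_le_iff_ne_zero.2 (by positivity)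
  have hB0 : (0 : ℝ) < B := by exact_mod_cast hB1
  set C₂ : ℝ := B * C₁ with hC₂
  set c₂ : ℝ := c₁ / B ^ 2 with hc₂
  have hC₂0 : 0 < C₂ := by positivity
  have hc₂0 : 0 < c₂ := by positivity
  refine ⟨C₂ + Real.exp (c₂ / 4 * (2 * tailIntegral d C₂ c₂) ^ 2), c₂ / 4, by positivity,
    by positivity, ?_⟩
  intro n Ω _ μ _ X hX hind hconc hmean Q hQd hQ1
  -- The tail lemmas need `n ≥ 1`; for `n = 0` the statistic is identically zero.
  rcases Nat.eq_zero_or_pos n with hn | hn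
  · subst hn
    have hZ : traceStatistic Q X = fun _ => 0 := by
      funext ω
      simp [traceStatistic, Matrix.trace]
    rw [hZ]
    refine ⟨integrable_const 0, fun t ht => ?_⟩
    have : {ω : Ω | t ≤ ‖(0 : ℂ) - ∫ _ω', (0 : ℂ) ∂μ‖} = ∅ := by
      ext ω
      simpa using ht
    rw [this, measureReal_empty]
    positivity
  have hn1 : 1 ≤ n := hn
  have hn0 : (0 : ℝ) < n := by exact_mod_cast hn1
  -- the joint law of the matrices
  set ν : Fin m → Measure (Matrix (Fin n) (Fin n) ℂ) := fun j => μ.map (X j) with hν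
  have hνp : ∀ j, IsProbabilityMeasure (ν j) := fun j =>
    Measure.isProbabilityMeasure_map (hX j).aemeasurable
  have hνc : ∀ j, MeanConcentration (ν j) K₁ (κ / 4) := fun j =>
    ConvexConcentration.meanConcentration (hX j) hK.le hκ (hconc j)
  have hjoint : Measurable fun ω j => X j ω := measurable_pi_lambda _ hX
  set P : Measure (Fin m → Matrix (Fin n) (Fin n) ℂ) := μ.map fun ω j => X j ω with hP
  have hPp : IsProbabilityMeasure P := Measure.isProbabilityMeasure_map hjoint.aemeasurable
  have hPpi : P = Measure.pi ν :=
    (iIndepFun_iff_map_fun_eq_pi_map fun j => (hX j).aemeasurable).1 hind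
  have hPc : MeanConcentration P (2 ^ m * K₁) (κ / 4 / 4 ^ m) := by
    rw [hPpi]
    exact MeanConcentration.pi hK₁0.le (by positivity) m ν hνp hνc
  have hop : P.real {x | ∃ j, ¬ OpBound (x j - meanMatrix μ (X j)) (τ * √n)} ≤ 1 / 4 := by
    have hmarg : ∀ j, P.real {x | ¬ OpBound (x j - meanMatrix μ (X j)) (τ * √n)}
        ≤ 1 / (4 * (m + 1)) := by
      intro j
      have hmap : P.map (fun x => x j) = ν j := by
        rw [hP, Measure.map_map (measurable_pi_apply j) hjoint]; rfl
      have h1 := measureReal_preimage_le_map (μ := P) (measurable_pi_apply j)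
        {x | ¬ OpBound (x - meanMatrix μ (X j)) (τ * √n)}
      rw [hmap] at h1
      refine h1.trans ?_
      have h2 := (hνc j).measure_not_opBound_le hK₁0 (by positivity) hn1
        (δ := 1 / (4 * (m + 1))) (by positivity)
      rw [meanMatrix_eq_map μ (hX j), ← mul_assoc] at h2
      exact h2
    have hunion : {x : Fin m → Matrix (Fin n) (Fin n) ℂ |
        ∃ j, ¬ OpBound (x j - meanMatrix μ (X j)) (τ * √n)}
        = ⋃ j ∈ (Finset.univ : Finset (Fin m)),
          {x | ¬ OpBound (x j - meanMatrix μ (X j)) (τ * √n)} := by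
      ext x; simp
    rw [hunion]
    refine (measureReal_biUnion_finset_le _ _).trans
      ((Finset.sum_le_sum fun j _ => hmarg j).trans ?_)
    rw [Finset.sum_const, Finset.card_univ, Fintype.card_fin, nsmul_eq_mul, mul_one_div,
      div_le_div_iff₀ (by positivity) (by positivity)]
    linarith
  have hschatten : 2 ≤ d → ∀ (w : List (Fin m ⊕ Fin m)) (z : ℂ), ‖z‖ = 1 →
      P.real {x | ¬ evenSchatten (d - 1) (wordHerm d w z x)
        ≤ (n : ℝ) ^ (1 / (2 * (d - 1 : ℕ) : ℝ)) * D} ≤ 1 / 4 := by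
    intro hd2 w z hz
    refine (measureReal_mono fun x hx => ?_).trans hop
    simp only [Set.mem_ofPred_eq] at hx ⊢
    by_contra! hcon
    refine hx (evenSchatten_wordHerm_le hd2 hn1 w hz hC₀.le hτ0 (fun j => ?_) hcon)
    have hcast : ((d - 1 : ℕ) : ℝ) = (d : ℝ) - 1 := by rw [Nat.cast_sub hd, Nat.cast_one]
    have hq0 : ((d - 1 : ℕ) : ℝ) ≠ 0 := by exact_mod_cast (by omega : d - 1 ≠ 0)
    have h1 := hmean hd2 j
    rw [← hcast] at h1
    refine (trace_pow_le_of_schattenNorm_le (by omega) h1).trans_eq ?_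
    rw [mul_pow]
    congr 1
    rw [← Real.rpow_natCast (_ ^ _), ← Real.rpow_mul hn0.le, ← Real.rpow_natCast (n : ℝ) d]
    congr 1
    push_cast
    field_simp
  -- tails of the statistic
  have hterm : ∀ (w : List (Fin m ⊕ Fin m)) (z : ℂ), ‖z‖ = 1 → ∃ a : ℂ, TailBound μ
      (fun ω => (posPartTrace d (isHermitian_wordHerm (d := d) w z fun j => X j ω) : ℂ))
      a d n C₁ c₁ := by
    intro w z hz
    obtain ⟨a, ha⟩ := hmain m n hn1 P hPp hPc w z hz fun hd2 => hschatten hd2 w z hz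
    refine ⟨(a : ℂ), fun t ht => le_trans ?_ (ha t ht)⟩
    refine le_trans (le_of_eq ?_) (measureReal_preimage_le_map hjoint _)
    congr 1
    ext ω
    simp only [Set.mem_ofPred_eq, Set.mem_preimage]
    rw [← Complex.ofReal_sub, Complex.norm_real]
  choose! a ha using hterm
  have hZ : traceStatistic Q X = fun ω =>
      ∑ p ∈ Q.coeff.support ×ˢ (Finset.range (2 * d + 1) ×ˢ Finset.range 2),
        (Q.coeff p.1 * expansionCoeff d p.2) * (posPartTrace d
          (isHermitian_wordHerm (d := d) p.1.toList (expansionPhase d p.2) fun j => X j ω) : ℂ) := by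
    funext ω
    rw [traceStatistic_eq_sum, Finset.sum_product]
    refine Finset.sum_congr rfl fun w hw => ?_
    rw [trace_word_eq_sum w.toList (hQd w (Finsupp.mem_support_iff.1 hw)) fun j => X j ω,
      Finset.mul_sum]
    exact Finset.sum_congr rfl fun p _ => (mul_assoc _ _ _).symm
  have hcard : (Q.coeff.support ×ˢ (Finset.range (2 * d + 1) ×ˢ Finset.range 2)).card ≤ B := by
    rw [Finset.card_product, Finset.card_product, Finset.card_range, Finset.card_range]
    exact Nat.mul_le_mul_right _ (card_support_le hQd)
  have htail := TailBound.sum hd hB1 hC₁.le hc₁.le _ hcard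
    (fun p ω => (posPartTrace d
      (isHermitian_wordHerm (d := d) p.1.toList (expansionPhase d p.2) fun j => X j ω) : ℂ))
    (fun p => a p.1.toList (expansionPhase d p.2))
    (fun p => Q.coeff p.1 * expansionCoeff d p.2)
    (fun p _ => by
      rw [norm_mul]
      exact mul_le_one₀ (hQ1 _) (norm_nonneg _) (norm_expansionCoeff_le _))
    (fun p _ => ha _ _ (norm_expansionPhase d p.2))
  rw [← hZ] at htail
  have hZm : AEStronglyMeasurable (traceStatistic Q X) μ :=
    (measurable_traceStatistic Q hX).aestronglyMeasurable
  exact ⟨(htail.integrable_and_norm_sub_le hZm hd hn1 hC₂0.le hc₂0).1,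
    htail.about_mean hZm hd hn1 hC₂0.le hc₂0⟩

lemma schattenNorm_zero {n : ℕ} {p : ℝ} (hp : 0 < p) :
    schattenNorm p (0 : Matrix (Fin n) (Fin n) ℂ) = 0 := by
  have h : ∀ i, (isHermitian_conjTranspose_mul_self
      (0 : Matrix (Fin n) (Fin n) ℂ)).eigenvalues i = 0 := by
    have : (isHermitian_conjTranspose_mul_self (0 : Matrix (Fin n) (Fin n) ℂ)).eigenvalues = 0 := by
      rw [IsHermitian.eigenvalues_eq_zero_iff]; simp
    exact congrFun this
  simp only [schattenNorm, h, Real.zero_rpow (div_pos hp two_pos).ne', Finset.sum_const_zero]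
  exact Real.zero_rpow (one_div_pos.2 hp).ne'

end

theorem theorem1 (m d : ℕ) (hd : 1 ≤ d) (K κ : ℝ) (hK : 0 < K) (hκ : 0 < κ) :
    -- centered matrices: the constants depend only on `m`, `d`, `K`, `κ`
    (∃ C c : ℝ, 0 < C ∧ 0 < c ∧
      ∀ (n : ℕ) (Ω : Type*) [MeasurableSpace Ω] (μ : Measure Ω) [IsProbabilityMeasure μ]
        (X : Fin m → Ω → Matrix (Fin n) (Fin n) ℂ),
        (∀ j, Measurable (X j)) → iIndepFun X μ →
        (∀ j, HSConvexConcentration μ (X j) K κ) →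
        (∀ j, meanMatrix μ (X j) = 0) →
        ∀ P : NCStarPolynomial m, P.DegreeLE d → P.Normalized →
          Integrable (traceStatistic P X) μ ∧
          ∀ t : ℝ, 0 < t →
            μ.real {ω | t ≤ ‖traceStatistic P X ω - ∫ ω', traceStatistic P X ω' ∂μ‖}
              ≤ C * Real.exp (-c * min (t ^ 2) (n * t ^ (2 / (d : ℝ))))) ∧
    -- non-centered matrices: they also depend on the constant `C₀` in the bound on the means
    (∀ C₀ : ℝ, 0 < C₀ → ∃ C c : ℝ, 0 < C ∧ 0 < c ∧
      ∀ (n : ℕ) (Ω : Type*) [MeasurableSpace Ω] (μ : Measure Ω) [IsProbabilityMeasure μ]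
        (X : Fin m → Ω → Matrix (Fin n) (Fin n) ℂ),
        (∀ j, Measurable (X j)) → iIndepFun X μ →
        (∀ j, HSConvexConcentration μ (X j) K κ) →
        (2 ≤ d → ∀ j, schattenNorm (2 * ((d : ℝ) - 1)) (meanMatrix μ (X j))
          ≤ C₀ * (n : ℝ) ^ ((d : ℝ) / (2 * ((d : ℝ) - 1)))) →
        ∀ P : NCStarPolynomial m, P.DegreeLE d → P.Normalized →
          Integrable (traceStatistic P X) μ ∧
          ∀ t : ℝ, 0 < t →
            μ.real {ω | t ≤ ‖traceStatistic P X ω - ∫ ω', traceStatistic P X ω' ∂μ‖}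
              ≤ C * Real.exp (-c * min (t ^ 2) (n * t ^ (2 / (d : ℝ))))) := by

  refine ⟨?_, fun C₀ hC₀ => exists_concentration m d hd K κ hK hκ C₀ hC₀⟩
  -- Centred means have Schatten norm zero, so any positive `C₀` would do.
  obtain ⟨C, c, hC, hc, h⟩ := exists_concentration m d hd K κ hK hκ 1 one_pos
  refine ⟨C, c, hC, hc, fun n Ω _ μ _ X hX hind hconc hmean => h n Ω μ X hX hind hconc ?_⟩
  intro hd2 j
  have hd' : (2 : ℝ) ≤ d := by exact_mod_cast hd2
  rw [hmean j, schattenNorm_zero (by linarith)]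
  positivity
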